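/- All functions are real valued and $C^\infty$. Let $f(x,u,p,q)$ be a function on an open set $U\subseteq\mathbb R^4$, let $V\subseteq\mathbb R^3$ be the image of $U$ under $(x,u,p,q)\mapsto(x,u,p)$, and let $s\in\mathbb R$. Write $$D_x=\partial_x+p\,\partial_u+q\,\partial_p,\qquad \hat D_x=D_x+f\,\partial_q ,$$ $$\omega^1=du-p\,dx,\quad \omega^2=dp-q\,dx,\quad \omega^3=dq-f\,dx,\quad \omega^4=dx,$$ and define on $U$ (with $J_3$ the real cube root of $I_3$) $$I_1=-f_q,\quad I_2=-\tfrac29I_1^2-f_p-\tfrac13\hat D_xI_1,\quad I_3=J_3^3=-\tfrac13I_1I_2-f_u-\tfrac12\hat D_xI_2,\quad I_4=(J_3)_q,$$ $$I_5=\frac{I_1J_3+3\hat D_xJ_3}{3J_3^2},\quad I_7=-(I_5)_qJ_3^2,\quad I_9=2J_3\hat D_xI_5-I_2+J_3^2I_5^2,\quad K=\frac{I_9}{J_3^2},$$ $$Q=-\frac{I_1I_7+3J_3^2(I_5)_p+3(J_3)_u-3J_3I_4\hat D_xI_5}{3J_3}.$$ A contact transformation on $V$ with multiplier $\lambda(x,u,p)$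 is a triple $(\varphi,\psi,\chi)$ of functions of $(x,u,p)\in V$ with nowhere zero Jacobian and $d\psi-\chi\,d\varphi=\lambda\,(du-p\,dx)$. We say that it carries $u'''=f(x,u,u',u'')$ on $U$ into $\bar u'''=s\bar u'+\bar u$ if $D_x\varphi\ne0$ on $U$ and its first prolongation $\Phi=(\varphi,\psi,\chi,D_x\chi/D_x\varphi)$ satisfies $$\Phi^*\begin{pmatrix}\bar\omega^1\\ \bar\omega^2\\ \bar\omega^3\\ \bar\omega^4\end{pmatrix}=\begin{pmatrix}a_1&0&0&0\\ a_2&a_3&0&0\\ a_4&a_5&a_6&0\\ a_7&a_8&0&a_9\end{pmatrix}\begin{pmatrix}\omega^1\\ \omega^2\\ \omega^3\\ \omega^4\end{pmatrix},\qquad a_1a_3a_6a_9\neq0,$$ for some functions $a_i$ on $U$, where $\bar\omega^1=d\bar u-\bar p\,d\bar x$, $\bar\omega^2=d\bar p-\bar q\,d\bar x$, $\bar\omega^3=d\bar q-(s\bar p+\bar u)\,d\bar x$, $\bar\omega^4=d\bar x$. Consider the following first-order linear systems on $U$, to be solved in this order for $a_1(x,u,p)$, then $\varphi(x,u,p)$,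 then $\eta(x,u,p,q)$, $\chi(x,u,p)$, $\psi(x,u,p)$. Step 1: $\;D_xa_1=J_3I_5a_1,\quad (a_1)_u=-Qa_1,\quad (a_1)_p=\bigl(I_4I_5-\tfrac{I_7}{J_3}\bigr)a_1,\quad (a_1)_q=0.$ Step 2: $\;\hat D_x\varphi=-J_3,\quad \varphi_u=-I_7,\quad \varphi_p=-I_4.$ Step 3: with $\bar f=s\chi+\psi$, $\chi=\hat D_x\psi/\hat D_x\varphi$ and $\eta=\hat D_x\chi/\hat D_x\varphi$, $$\hat D_x\eta=-J_3\bar f,\quad \eta_u=\Bigl(\frac{s+I_5^2}{2}+\frac{I_2}{2J_3^2}\Bigr)a_1-I_7\bar f,\quad \eta_p=\Bigl(\frac{I_5}{J_3}+\frac{I_1}{3J_3^2}\Bigr)a_1-I_4\bar f,\quad \eta_q=\frac{a_1}{J_3^2},$$ $$\hat D_x\chi=-J_3\eta,\quad \chi_u=-I_5a_1-I_7\eta,\quad \chi_p=-\frac{a_1}{J_3}-I_4\eta,$$ $$I_7\hat D_x\psi=J_3(\psi_u-a_1),\quad \psi_x=\chi\varphi_x-pa_1,\quad \psi_p=-I_4\chi.$$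 **Proposition.** Suppose that a contact transformation $(\varphi,\psi,\chi)$ on $V$ with multiplier $\lambda$ carries $u'''=f(x,u,u',u'')$ on $U$ into $\bar u'''=s\bar u'+\bar u$. Then: (a) $I_3\neq0$ and $K=s$ on $U$. (b) $\lambda$ is nowhere zero on $V$; $a_1=\lambda$ solves the system of Step 1, $\varphi$ solves that of Step 2, and $\eta=D_x\chi/D_x\varphi$, $\chi$, $\psi$ solve that of Step 3 for $a_1=\lambda$ and this $\varphi$. (c) For every nowhere vanishing solution $a_1$ of Step 1 and every solution $\varphi$ of Step 2 the system of Step 3 has a solution. (d) If $a_1$ is a nowhere vanishing solution of Step 1, $\varphi$ a solution of Step 2, and $\eta,\chi,\psi$ a solution of Step 3 for these, then $(\varphi,\psi,\chi)$ is a contact transformation on $V$ with multiplier $a_1$ that carries $u'''=f$ on $U$ into $\bar u'''=s\bar u'+\bar u$, and $\eta=D_x\chi/D_x\varphi$. (e) If $U$ is connected, every solution $a_1$ of Step 1 that is not identically zero is nowhere zero. -/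

import Mathlib

open scoped ContDiff

noncomputable section

namespace ContactODE

/-- First-order jet space, with coordinates `v 0 = x`, `v 1 = u`, `v 2 = p`. -/
abbrev J1 : Type := Fin 3 → ℝ

/-- Second-order jet space, with coordinates `z 0 = x`, `z 1 = u`, `z 2 = p`, `z 3 = q`. -/
abbrev J2 : Type := Fin 4 → ℝ

/-- The projection `(x, u, p, q) ↦ (x, u, p)`. -/
def proj (z : J2) : J1 := ![z 0, z 1, z 2]

/-- A function of `(x, u, p)` regarded as a function of `(x, u, p, q)`. -/
def lift (g : J1 → ℝ) : J2 → ℝ := fun z => g (proj z)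

/-- The partial derivative of `g` with respect to the `i`-th coordinate. -/
def pd {n : ℕ} (i : Fin n) (g : (Fin n → ℝ) → ℝ) : (Fin n → ℝ) → ℝ :=
  fun z => fderiv ℝ g z (Pi.single i 1)

/-- The total derivative `D_x = ∂_x + p ∂_u + q ∂_p`. -/
def Dx (g : J2 → ℝ) : J2 → ℝ := fun z => pd 0 g z + z 2 * pd 1 g z + z 3 * pd 2 g z

/-- The total derivative along `u''' = f`, namely `∂_x + p ∂_u + q ∂_p + f ∂_q`. -/
def Dhat (f g : J2 → ℝ) : J2 → ℝ := fun z => Dx g z + f z * pd 3 g z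

/-- The real cube root. -/
def cbrt (t : ℝ) : ℝ := Real.sign t * |t| ^ (3⁻¹ : ℝ)

theorem cbrt_pow_three (t : ℝ) : cbrt t ^ 3 = t := by
  have h : (|t| ^ (3⁻¹ : ℝ)) ^ 3 = |t| := by
    have := Real.rpow_inv_natCast_pow (abs_nonneg t) (n := 3) (by norm_num)
    simpa using this
  unfold cbrt
  rw [mul_pow, h]
  rcases lt_trichotomy t 0 with ht | ht | ht
  · rw [Real.sign_of_neg ht, abs_of_neg ht]; ring
  · simp [ht]
  · rw [Real.sign_of_pos ht, abs_of_pos ht]; ring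

/-! The functions on the second-order jet space attached to `u''' = f`. -/

def I1 (f : J2 → ℝ) : J2 → ℝ := fun z => -pd 3 f z

def I2 (f : J2 → ℝ) : J2 → ℝ := fun z =>
  -(2 / 9) * I1 f z ^ 2 - pd 2 f z - (1 / 3) * Dhat f (I1 f) z

def I3 (f : J2 → ℝ) : J2 → ℝ := fun z =>
  -(1 / 3) * I1 f z * I2 f z - pd 1 f z - (1 / 2) * Dhat f (I2 f) z

def J3 (f : J2 → ℝ) : J2 → ℝ := fun z => cbrt (I3 f z)

def I4 (f : J2 → ℝ) : J2 → ℝ := fun z => pd 3 (J3 f) z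

def I5 (f : J2 → ℝ) : J2 → ℝ := fun z =>
  1 / (3 * J3 f z ^ 2) * (I1 f z * J3 f z + 3 * Dhat f (J3 f) z)

def I7 (f : J2 → ℝ) : J2 → ℝ := fun z => -pd 3 (I5 f) z * J3 f z ^ 2

def I9 (f : J2 → ℝ) : J2 → ℝ := fun z =>
  2 * J3 f z * Dhat f (I5 f) z - I2 f z + J3 f z ^ 2 * I5 f z ^ 2

def K (f : J2 → ℝ) : J2 → ℝ := fun z => I9 f z / J3 f z ^ 2

def Q (f : J2 → ℝ) : J2 → ℝ := fun z =>
  -((I1 f z * I7 f z + 3 * J3 f z ^ 2 * pd 2 (I5 f) z + 3 * pd 1 (J3 f) z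
      - 3 * J3 f z * I4 f z * Dhat f (I5 f) z) / (3 * J3 f z))

/-- The base coframe `(du - p dx, dp - q dx, dq - f dx, dx)` of `u''' = f` at the point `z`. -/
def coframe (f : J2 → ℝ) (z : J2) : Fin 4 → (J2 →L[ℝ] ℝ) :=
  let d : Fin 4 → (J2 →L[ℝ] ℝ) := fun i => ContinuousLinearMap.proj i
  ![d 1 - z 2 • d 0, d 2 - z 3 • d 0, d 3 - f z • d 0, d 0]

/-- The structure group of the equivalence problem. -/
def structureGroup : Set (Matrix (Fin 4) (Fin 4) ℝ) :=
  {A | ∃ a1 a2 a3 a4 a5 a6 a7 a8 a9 : ℝ, a1 * a3 * a6 * a9 ≠ 0 ∧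
    A = !![a1, 0,  0,  0;
           a2, a3, 0,  0;
           a4, a5, a6, 0;
           a7, a8, 0,  a9]}

/-- `(φ, ψ, χ)` is a smooth contact transformation on the open set `V` with multiplier `lam`:
`dψ - χ dφ = lam (du - p dx)`, with non-zero Jacobian. -/
structure IsContactTransformation (V : Set J1) (φ ψ χ lam : J1 → ℝ) : Prop where
  smooth_φ : ContDiffOn ℝ ∞ φ V
  smooth_ψ : ContDiffOn ℝ ∞ ψ V
  smooth_χ : ContDiffOn ℝ ∞ χ V
  contact : ∀ v ∈ V, fderiv ℝ ψ v - χ v • fderiv ℝ φ v =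
    lam v • ((ContinuousLinearMap.proj 1 : J1 →L[ℝ] ℝ) -
      v 2 • (ContinuousLinearMap.proj 0 : J1 →L[ℝ] ℝ))
  jacobian : ∀ v ∈ V, (fderiv ℝ (fun w : J1 => ![φ w, ψ w, χ w]) v).det ≠ 0

/-- The last component `q̄ = D_x χ / D_x φ` of the first prolongation. -/
def prolongQ (φ χ : J1 → ℝ) : J2 → ℝ := fun z => Dx (lift χ) z / Dx (lift φ) z

/-- The first prolongation of `(φ, ψ, χ)` to the second-order jet space. -/
def prolong (φ ψ χ : J1 → ℝ) : J2 → J2 :=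
  fun z => ![lift φ z, lift ψ z, lift χ z, prolongQ φ χ z]

/-- `u''' = f` on the open set `U` and `ū''' = fbar` are equivalent under the contact
transformation `(φ, ψ, χ)` with multiplier `lam`: its first prolongation `Φ` is defined on `U`
(that is, `D_x φ ≠ 0`), and it pulls the base coframe of `fbar` back to the base coframe of `f`
multiplied by a function with values in the structure group. -/
structure IsContactEquivalence (U : Set J2) (f fbar : J2 → ℝ) (φ ψ χ lam : J1 → ℝ) : Prop where
  contactTransformation : IsContactTransformation (proj '' U) φ ψ χ lam
  prolongable : ∀ z ∈ U, Dx (lift φ) z ≠ 0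
  pullback : ∀ z ∈ U, ∃ A ∈ structureGroup, ∀ i : Fin 4,
    (coframe fbar (prolong φ ψ χ z) i).comp (fderiv ℝ (prolong φ ψ χ) z) =
      ∑ j, A i j • coframe f z j

/-- The right-hand side of the canonical form `ū''' = s ū' + ū`. -/
def canonicalRHS (s : ℝ) : J2 → ℝ := fun z => s * z 2 + z 1

/-- The first-order linear system for the auxiliary function `a1(x, u, p)`. -/
structure StepOne (U : Set J2) (f : J2 → ℝ) (a1 : J1 → ℝ) : Prop where
  smooth : ContDiffOn ℝ ∞ a1 (proj '' U)
  a1_x : ∀ z ∈ U, Dx (lift a1) z = J3 f z * I5 f z * lift a1 z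
  a1_u : ∀ z ∈ U, pd 1 (lift a1) z = -Q f z * lift a1 z
  a1_p : ∀ z ∈ U, pd 2 (lift a1) z = (I4 f z * I5 f z - I7 f z / J3 f z) * lift a1 z
  a1_q : ∀ z ∈ U, pd 3 (lift a1) z = 0

/-- The first-order linear system for `φ(x, u, p)`. -/
structure StepTwo (U : Set J2) (f : J2 → ℝ) (φ : J1 → ℝ) : Prop where
  smooth : ContDiffOn ℝ ∞ φ (proj '' U)
  φ_x : ∀ z ∈ U, Dhat f (lift φ) z = -J3 f z
  φ_u : ∀ z ∈ U, pd 1 (lift φ) z = -I7 f z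
  φ_p : ∀ z ∈ U, pd 2 (lift φ) z = -I4 f z

/-- The first-order linear system for `η(x, u, p, q)`, `χ(x, u, p)`, `ψ(x, u, p)`, given `a1`
and `φ`; here `f̄ = s χ + ψ`, and `χ`, `η` are the total derivatives of `ψ`, `χ` divided by that
of `φ`. -/
structure StepThree (U : Set J2) (f : J2 → ℝ) (s : ℝ) (a1 φ : J1 → ℝ)
    (η : J2 → ℝ) (χ ψ : J1 → ℝ) : Prop where
  smooth_η : ContDiffOn ℝ ∞ η U
  smooth_χ : ContDiffOn ℝ ∞ χ (proj '' U)
  smooth_ψ : ContDiffOn ℝ ∞ ψ (proj '' U)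
  η_x : ∀ z ∈ U, Dhat f η z = -J3 f z * (s * lift χ z + lift ψ z)
  η_u : ∀ z ∈ U, pd 1 η z =
    ((s + I5 f z ^ 2) / 2 + I2 f z / (2 * J3 f z ^ 2)) * lift a1 z
      - I7 f z * (s * lift χ z + lift ψ z)
  η_p : ∀ z ∈ U, pd 2 η z =
    (I5 f z / J3 f z + I1 f z / (3 * J3 f z ^ 2)) * lift a1 z
      - I4 f z * (s * lift χ z + lift ψ z)
  η_q : ∀ z ∈ U, pd 3 η z = lift a1 z / J3 f z ^ 2
  χ_x : ∀ z ∈ U, Dhat f (lift χ) z = -J3 f z * η z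
  χ_u : ∀ z ∈ U, pd 1 (lift χ) z = -I5 f z * lift a1 z - I7 f z * η z
  χ_p : ∀ z ∈ U, pd 2 (lift χ) z = -(lift a1 z / J3 f z) - I4 f z * η z
  ψ_u : ∀ z ∈ U, I7 f z * Dhat f (lift ψ) z = J3 f z * (pd 1 (lift ψ) z - lift a1 z)
  ψ_x : ∀ z ∈ U, pd 0 (lift ψ) z = lift χ z * pd 0 (lift φ) z - z 2 * lift a1 z
  ψ_p : ∀ z ∈ U, pd 2 (lift ψ) z = -I4 f z * lift χ z
  χ_eq : ∀ z ∈ U, lift χ z = Dhat f (lift ψ) z / Dhat f (lift φ) z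
  η_eq : ∀ z ∈ U, η z = Dhat f (lift χ) z / Dhat f (lift φ) z

end ContactODE

end

/-! Write σ = -D_xφ, l = λ and m = D_xλ/(λσ). The contact condition and the third row of the
pullback say that `Dhat` sends ψ, χ, η to χ, η, sχ + ψ times `Dhat` φ. Since [∂_q, D̂] = ∂_p + f_q
∂_q, [∂_p, D̂] = ∂_u + f_p ∂_q and [∂_u, D̂] = f_u ∂_q, applying ∂_i to D̂g = h D̂φ expresses dh
modulo dφ through dg modulo dφ (`pd_three_of_Dhat_eq_mul` and its two companions). Starting from dψ
- χ dφ = l ω¹ this yields all derivatives of χ and η. One step further h = sχ + ψ, whose derivatives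
are already known, so the same identities become constraints: ∂_q gives m = `I5` (`σ_x`), ∂_p gives
`K` = s (`m_x`), ∂_u gives `I3` = σ³ (`I3_eq`), hence σ = `J3`. The remaining derivatives of φ and l
come from [∂_q, D̂] and from equality of the mixed partials of ψ and χ. Thus the given
transformation solves the three systems.

Every other solution is compared with this one. Step 1 fixes the logarithmic derivatives of a1, so c
= a1/λ has zero derivative; Step 2 fixes dφ. Step 3 involves φ only through dφ and is homogeneous in
(a1, η, χ, ψ), so (cη, cχ, cψ) solves it for the new data (`StepThree.lift_mul`). On a connected U
the function c is constant, which gives the dichotomy for a1. Conversely, the equations of Steps 2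
and 3 are the entries of the pullback matrix (`StepThree.isContactEquivalence`). -/

noncomputable section

namespace ContactODE

/-! ### Calculus of directional derivatives -/

/-- The derivative of `g` along the vector field `w`. -/
def dirDeriv {n : ℕ} (w : (Fin n → ℝ) → (Fin n → ℝ)) (g : (Fin n → ℝ) → ℝ) : (Fin n → ℝ) → ℝ :=
  fun z => fderiv ℝ g z (w z)

/-- The vector field `∂_x + p ∂_u + q ∂_p + f ∂_q`. -/
def totalField (f : J2 → ℝ) : J2 → J2 := fun z => ![1, z 2, z 3, f z]

theorem fderiv_apply_eq_sum {n : ℕ} (g : (Fin n → ℝ) → ℝ) (z w : Fin n → ℝ) :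
    fderiv ℝ g z w = ∑ i, w i * pd i g z := by
  conv_lhs => rw [pi_eq_sum_univ' w, map_sum]
  refine Finset.sum_congr rfl fun i _ => ?_
  rw [map_smul, smul_eq_mul, pd]

/-- Coordinate derivatives and `Dhat` are both derivatives along a vector field, so the rules of
calculus are proved once for `dirDeriv` and transferred to each. -/
theorem pd_eq_dirDeriv {n : ℕ} (i : Fin n) (g : (Fin n → ℝ) → ℝ) :
    pd i g = dirDeriv (fun _ => Pi.single i 1) g := rfl

theorem Dhat_eq_dirDeriv (f g : J2 → ℝ) : Dhat f g = dirDeriv (totalField f) g := by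
  ext z
  rw [dirDeriv, fderiv_apply_eq_sum, Fin.sum_univ_four]
  simp [Dhat, Dx, totalField]

section Rules

variable {n : ℕ} {w : (Fin n → ℝ) → (Fin n → ℝ)} {g h : (Fin n → ℝ) → ℝ} {z : Fin n → ℝ}

theorem dirDeriv_congr {U : Set (Fin n → ℝ)} (hU : IsOpen U) (e : ∀ z ∈ U, g z = h z)
    (hz : z ∈ U) : dirDeriv w g z = dirDeriv w h z := by
  have : g =ᶠ[nhds z] h := Filter.eventually_of_mem (hU.mem_nhds hz) e
  rw [dirDeriv, this.fderiv_eq, dirDeriv]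

theorem dirDeriv_const (c : ℝ) : dirDeriv w (fun _ => c) z = 0 := by
  simp [dirDeriv]

theorem dirDeriv_add (hg : DifferentiableAt ℝ g z) (hh : DifferentiableAt ℝ h z) :
    dirDeriv w (fun z => g z + h z) z = dirDeriv w g z + dirDeriv w h z := by
  simp [dirDeriv, fderiv_fun_add hg hh]

theorem dirDeriv_neg : dirDeriv w (fun z => -g z) z = -dirDeriv w g z := by
  simp [dirDeriv, fderiv_fun_neg]

theorem dirDeriv_mul (hg : DifferentiableAt ℝ g z) (hh : DifferentiableAt ℝ h z) :
    dirDeriv w (fun z => g z * h z) z = dirDeriv w g z * h z + g z * dirDeriv w h z := by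
  simp [dirDeriv, fderiv_fun_mul hg hh]
  ring

theorem dirDeriv_const_mul (c : ℝ) (hg : DifferentiableAt ℝ g z) :
    dirDeriv w (fun z => c * g z) z = c * dirDeriv w g z := by
  simp [dirDeriv, fderiv_const_mul hg]

theorem dirDeriv_div (hg : DifferentiableAt ℝ g z) (hh : DifferentiableAt ℝ h z) (h0 : h z ≠ 0) :
    dirDeriv w (fun z => g z / h z) z
      = (dirDeriv w g z * h z - g z * dirDeriv w h z) / h z ^ 2 := by
  -- The quotient rule is solved from the product rule for (g / h) · h, which agrees with g near z
  -- because h stays nonzero there.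
  have key : dirDeriv w (fun z => g z / h z * h z) z = dirDeriv w g z := by
    have : (fun z => g z / h z * h z) =ᶠ[nhds z] g := by
      filter_upwards [hh.continuousAt.eventually_ne h0] with y hy
      field_simp
    rw [dirDeriv, this.fderiv_eq, dirDeriv]
  have hq : DifferentiableAt ℝ (fun z => g z / h z) z := by
    simpa only [div_eq_mul_inv] using hg.fun_mul (hh.fun_inv h0)
  rw [dirDeriv_mul hq hh] at key
  rw [← key]
  field_simp
  ring

theorem differentiableAt_of_contDiffOn {U : Set (Fin n → ℝ)} (hU : IsOpen U)
    (hg : ContDiffOn ℝ ∞ g U) (hz : z ∈ U) : DifferentiableAt ℝ g z :=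
  (hg.contDiffAt (hU.mem_nhds hz)).differentiableAt (by simp)

theorem contDiffOn_dirDeriv {U : Set (Fin n → ℝ)} (hU : IsOpen U) (hg : ContDiffOn ℝ ∞ g U)
    (hw : ContDiffOn ℝ ∞ w U) : ContDiffOn ℝ ∞ (dirDeriv w g) U :=
  (hg.fderiv_of_isOpen hU (m := ∞) (by simp)).clm_apply hw

theorem contDiffOn_pd {U : Set (Fin n → ℝ)} (hU : IsOpen U) (hg : ContDiffOn ℝ ∞ g U)
    (i : Fin n) : ContDiffOn ℝ ∞ (pd i g) U :=
  contDiffOn_dirDeriv hU hg contDiffOn_const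

theorem pd_comm (hg : ContDiffAt ℝ ∞ g z) (i j : Fin n) : pd i (pd j g) z = pd j (pd i g) z := by
  have hd : DifferentiableAt ℝ (fderiv ℝ g) z :=
    (hg.fderiv_right (m := 1) (by norm_cast)).differentiableAt (by simp)
  have hs : IsSymmSndFDerivAt ℝ g z :=
    hg.isSymmSndFDerivAt (by simp [minSmoothness_of_isRCLikeNormedField]; norm_cast)
  have key : ∀ a b : Fin n → ℝ,
      fderiv ℝ (fun y => fderiv ℝ g y a) z b = fderiv ℝ (fderiv ℝ g) z b a := fun a b => by
    rw [fderiv_clm_apply hd (differentiableAt_const a)]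
    simp
  unfold pd
  rw [key, key]
  exact hs.eq _ _

end Rules

/-! ### Functions on the jet spaces -/

theorem contDiff_proj : ContDiff ℝ ∞ proj := by
  rw [contDiff_pi]
  intro i
  fin_cases i <;> simp [proj] <;> fun_prop

/-- A surjective continuous linear map is open; appending q = 0 gives a preimage. Openness of the
image of U lets smoothness on that image yield differentiability at its points. -/
theorem isOpenMap_proj : IsOpenMap proj := by
  let L : J2 →L[ℝ] J1 := ContinuousLinearMap.pi
    ![ContinuousLinearMap.proj 0, ContinuousLinearMap.proj 1, ContinuousLinearMap.proj 2]
  have hL : (L : J2 → J1) = proj := by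
    ext z i
    fin_cases i <;> simp [L, proj]
  rw [← hL]
  refine L.isOpenMap fun v => ⟨![v 0, v 1, v 2, 0], ?_⟩
  rw [hL]
  ext i
  fin_cases i <;> simp [proj]

theorem hasFDerivAt_proj (z : J2) : HasFDerivAt proj (ContinuousLinearMap.pi
    ![ContinuousLinearMap.proj 0, ContinuousLinearMap.proj 1, ContinuousLinearMap.proj 2] :
      J2 →L[ℝ] J1) z := by
  rw [hasFDerivAt_pi']
  intro i
  fin_cases i
  exacts [(ContinuousLinearMap.proj (R := ℝ) (φ := fun _ : Fin 4 => ℝ) 0).hasFDerivAt,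
    (ContinuousLinearMap.proj (R := ℝ) (φ := fun _ : Fin 4 => ℝ) 1).hasFDerivAt,
    (ContinuousLinearMap.proj (R := ℝ) (φ := fun _ : Fin 4 => ℝ) 2).hasFDerivAt]

section Lift

variable {U : Set J2} {g : J1 → ℝ} {z : J2}

theorem fderiv_lift_apply (hg : DifferentiableAt ℝ g (proj z)) (w : J2) :
    fderiv ℝ (lift g) z w = fderiv ℝ g (proj z) ![w 0, w 1, w 2] := by
  have h : HasFDerivAt (lift g) _ z := hg.hasFDerivAt.comp z (hasFDerivAt_proj z)
  rw [h.fderiv]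
  simp only [ContinuousLinearMap.comp_apply]
  congr 1
  ext i
  fin_cases i <;> simp

theorem pd_lift_zero (hg : DifferentiableAt ℝ g (proj z)) :
    pd 0 (lift g) z = pd 0 g (proj z) := by
  rw [pd, fderiv_lift_apply hg, pd]
  congr 1
  ext i
  fin_cases i <;> simp

theorem pd_lift_one (hg : DifferentiableAt ℝ g (proj z)) :
    pd 1 (lift g) z = pd 1 g (proj z) := by
  rw [pd, fderiv_lift_apply hg, pd]
  congr 1
  ext i
  fin_cases i <;> simp

theorem pd_lift_two (hg : DifferentiableAt ℝ g (proj z)) :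
    pd 2 (lift g) z = pd 2 g (proj z) := by
  rw [pd, fderiv_lift_apply hg, pd]
  congr 1
  ext i
  fin_cases i <;> simp

theorem pd_lift_three (hg : DifferentiableAt ℝ g (proj z)) : pd 3 (lift g) z = 0 := by
  rw [pd, fderiv_lift_apply hg]
  have h : (![(Pi.single 3 1 : J2) 0, (Pi.single 3 1 : J2) 1, (Pi.single 3 1 : J2) 2] : J1) = 0 := by
    ext i
    fin_cases i <;> simp
  rw [h, map_zero]

theorem isOpen_image_proj (hU : IsOpen U) : IsOpen (proj '' U) := isOpenMap_proj U hU

theorem contDiffOn_lift (hg : ContDiffOn ℝ ∞ g (proj '' U)) : ContDiffOn ℝ ∞ (lift g) U :=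
  hg.comp contDiff_proj.contDiffOn (Set.mapsTo_image _ _)

theorem differentiableAt_of_mem_image_proj (hU : IsOpen U) (hg : ContDiffOn ℝ ∞ g (proj '' U))
    (hz : z ∈ U) : DifferentiableAt ℝ g (proj z) :=
  differentiableAt_of_contDiffOn (isOpen_image_proj hU) hg (Set.mem_image_of_mem _ hz)

theorem pd_three_lift (hU : IsOpen U) (hg : ContDiffOn ℝ ∞ g (proj '' U)) (hz : z ∈ U) :
    pd 3 (lift g) z = 0 :=
  pd_lift_three (differentiableAt_of_mem_image_proj hU hg hz)

theorem Dhat_lift (f : J2 → ℝ) (hU : IsOpen U) (hg : ContDiffOn ℝ ∞ g (proj '' U)) (hz : z ∈ U) :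
    Dhat f (lift g) z = Dx (lift g) z := by
  rw [Dhat, pd_three_lift hU hg hz, mul_zero, add_zero]

end Lift

theorem contDiffOn_totalField {U : Set J2} {f : J2 → ℝ} (hf : ContDiffOn ℝ ∞ f U) :
    ContDiffOn ℝ ∞ (totalField f) U := by
  rw [contDiffOn_pi]
  intro i
  fin_cases i <;> simp [totalField] <;> first | exact hf | fun_prop

theorem contDiffOn_Dhat {U : Set J2} {f g : J2 → ℝ} (hU : IsOpen U) (hf : ContDiffOn ℝ ∞ f U)
    (hg : ContDiffOn ℝ ∞ g U) : ContDiffOn ℝ ∞ (Dhat f g) U := by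
  rw [Dhat_eq_dirDeriv]
  exact contDiffOn_dirDeriv hU hg (contDiffOn_totalField hf)

theorem contDiffOn_Dx {U : Set J2} {g : J2 → ℝ} (hU : IsOpen U)
    (hg : ContDiffOn ℝ ∞ g U) : ContDiffOn ℝ ∞ (Dx g) U := by
  have h : Dx g = Dhat (fun _ => 0) g := by
    ext z
    simp [Dhat]
  rw [h]
  exact contDiffOn_Dhat hU contDiffOn_const hg

/-- The commutator of `∂_i` with the total derivative. -/
theorem pd_Dhat {U : Set J2} {f g : J2 → ℝ} {z : J2} (hU : IsOpen U) (hf : ContDiffOn ℝ ∞ f U)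
    (hg : ContDiffOn ℝ ∞ g U) (hz : z ∈ U) (i : Fin 4) :
    pd i (Dhat f g) z = Dhat f (pd i g) z + (Pi.single i 1 : J2) 2 * pd 1 g z
      + (Pi.single i 1 : J2) 3 * pd 2 g z + pd i f z * pd 3 g z := by
  have dg : ∀ j, DifferentiableAt ℝ (pd j g) z := fun j =>
    differentiableAt_of_contDiffOn hU (contDiffOn_pd hU hg j) hz
  have df := differentiableAt_of_contDiffOn hU hf hz
  have dc : ∀ j : Fin 4, DifferentiableAt ℝ (fun z : J2 => z j) z := fun j => by fun_prop
  have hc : ∀ j : Fin 4, pd i (fun z : J2 => z j) z = (Pi.single i 1 : J2) j := fun j => by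
    have h : HasFDerivAt (fun z : J2 => z j) (ContinuousLinearMap.proj j : J2 →L[ℝ] ℝ) z :=
      (ContinuousLinearMap.proj j : J2 →L[ℝ] ℝ).hasFDerivAt
    rw [pd, h.fderiv, ContinuousLinearMap.proj_apply]
  have cm : ∀ j, pd i (pd j g) z = pd j (pd i g) z := fun j =>
    pd_comm (hg.contDiffAt (hU.mem_nhds hz)) i j
  simp only [pd_eq_dirDeriv] at dg hc cm ⊢
  unfold Dhat Dx
  simp only [pd_eq_dirDeriv]
  rw [dirDeriv_add (((dg 0).fun_add ((dc 2).fun_mul (dg 1))).fun_add ((dc 3).fun_mul (dg 2)))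
      (df.fun_mul (dg 3)),
    dirDeriv_add ((dg 0).fun_add ((dc 2).fun_mul (dg 1))) ((dc 3).fun_mul (dg 2)),
    dirDeriv_add (dg 0) ((dc 2).fun_mul (dg 1)), dirDeriv_mul (dc 2) (dg 1),
    dirDeriv_mul (dc 3) (dg 2), dirDeriv_mul df (dg 3), hc, hc, cm, cm, cm, cm]
  ring

section PdRules

variable {n : ℕ} {g h : (Fin n → ℝ) → ℝ} {z : Fin n → ℝ} (i : Fin n)

theorem pd_congr {U : Set (Fin n → ℝ)} (hU : IsOpen U) (e : ∀ z ∈ U, g z = h z) (hz : z ∈ U) :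
    pd i g z = pd i h z := by
  simp only [pd_eq_dirDeriv]
  exact dirDeriv_congr hU e hz

theorem pd_neg :
    pd i (fun z => -g z) z = -pd i g z := by
  simp only [pd_eq_dirDeriv]
  exact dirDeriv_neg

theorem pd_add (hg : DifferentiableAt ℝ g z) (hh : DifferentiableAt ℝ h z) :
    pd i (fun z => g z + h z) z = pd i g z + pd i h z := by
  simp only [pd_eq_dirDeriv]
  exact dirDeriv_add hg hh

theorem pd_mul (hg : DifferentiableAt ℝ g z) (hh : DifferentiableAt ℝ h z) :
    pd i (fun z => g z * h z) z = pd i g z * h z + g z * pd i h z := by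
  simp only [pd_eq_dirDeriv]
  exact dirDeriv_mul hg hh

theorem pd_const_mul (c : ℝ) (hg : DifferentiableAt ℝ g z) :
    pd i (fun z => c * g z) z = c * pd i g z := by
  simp only [pd_eq_dirDeriv]
  exact dirDeriv_const_mul c hg

theorem pd_div (hg : DifferentiableAt ℝ g z) (hh : DifferentiableAt ℝ h z) (h0 : h z ≠ 0) :
    pd i (fun z => g z / h z) z = (pd i g z * h z - g z * pd i h z) / h z ^ 2 := by
  simp only [pd_eq_dirDeriv]
  exact dirDeriv_div hg hh h0

end PdRules

section DhatRules

variable {f g h : J2 → ℝ} {z : J2}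

theorem Dhat_congr {U : Set J2} (hU : IsOpen U) (e : ∀ z ∈ U, g z = h z) (hz : z ∈ U) :
    Dhat f g z = Dhat f h z := by
  simp only [Dhat_eq_dirDeriv]
  exact dirDeriv_congr hU e hz

theorem Dhat_const (c : ℝ) :
    Dhat f (fun _ => c) z = 0 := by
  simp only [Dhat_eq_dirDeriv]
  exact dirDeriv_const c

theorem Dhat_neg :
    Dhat f (fun z => -g z) z = -Dhat f g z := by
  simp only [Dhat_eq_dirDeriv]
  exact dirDeriv_neg

theorem Dhat_add (hg : DifferentiableAt ℝ g z) (hh : DifferentiableAt ℝ h z) :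
    Dhat f (fun z => g z + h z) z = Dhat f g z + Dhat f h z := by
  simp only [Dhat_eq_dirDeriv]
  exact dirDeriv_add hg hh

theorem Dhat_mul (hg : DifferentiableAt ℝ g z) (hh : DifferentiableAt ℝ h z) :
    Dhat f (fun z => g z * h z) z = Dhat f g z * h z + g z * Dhat f h z := by
  simp only [Dhat_eq_dirDeriv]
  exact dirDeriv_mul hg hh

theorem Dhat_const_mul (c : ℝ) (hg : DifferentiableAt ℝ g z) :
    Dhat f (fun z => c * g z) z = c * Dhat f g z := by
  simp only [Dhat_eq_dirDeriv]
  exact dirDeriv_const_mul c hg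

theorem Dhat_div (hg : DifferentiableAt ℝ g z) (hh : DifferentiableAt ℝ h z) (h0 : h z ≠ 0) :
    Dhat f (fun z => g z / h z) z = (Dhat f g z * h z - g z * Dhat f h z) / h z ^ 2 := by
  simp only [Dhat_eq_dirDeriv]
  exact dirDeriv_div hg hh h0

end DhatRules

/-! ### Consequences of the commutation relations -/

section Step

variable {U : Set J2} {f φ g h a b c : J2 → ℝ} {z : J2}

theorem pd_one_Dhat (hU : IsOpen U) (hf : ContDiffOn ℝ ∞ f U) (hg : ContDiffOn ℝ ∞ g U)
    (hz : z ∈ U) : pd 1 (Dhat f g) z = Dhat f (pd 1 g) z + pd 1 f z * pd 3 g z := by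
  rw [pd_Dhat hU hf hg hz]
  simp

theorem pd_two_Dhat (hU : IsOpen U) (hf : ContDiffOn ℝ ∞ f U) (hg : ContDiffOn ℝ ∞ g U)
    (hz : z ∈ U) : pd 2 (Dhat f g) z = Dhat f (pd 2 g) z + pd 1 g z + pd 2 f z * pd 3 g z := by
  rw [pd_Dhat hU hf hg hz]
  simp

theorem pd_three_Dhat (hU : IsOpen U) (hf : ContDiffOn ℝ ∞ f U) (hg : ContDiffOn ℝ ∞ g U)
    (hz : z ∈ U) : pd 3 (Dhat f g) z = Dhat f (pd 3 g) z + pd 2 g z + pd 3 f z * pd 3 g z := by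
  rw [pd_Dhat hU hf hg hz]
  simp

/-- Here dg - h dφ = a ω¹ + b ω² + c ω³. Applying ∂_q to the equation for `Dhat` g, the term h φ_p
appears on both sides and cancels. The result gives h_q when h is unknown, and is a constraint on b
and c when h_q is known. The two lemmas below do the same with ∂_p and ∂_u. -/
theorem pd_three_of_Dhat_eq_mul (hU : IsOpen U) (hf : ContDiffOn ℝ ∞ f U)
    (hφ : ContDiffOn ℝ ∞ φ U) (hg : ContDiffOn ℝ ∞ g U) (hh : ContDiffOn ℝ ∞ h U)
    (φq : ∀ z ∈ U, pd 3 φ z = 0) (gx : ∀ z ∈ U, Dhat f g z = h z * Dhat f φ z)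
    (gp : ∀ z ∈ U, pd 2 g z = h z * pd 2 φ z + b z) (gq : ∀ z ∈ U, pd 3 g z = c z) (hz : z ∈ U) :
    pd 3 h z * Dhat f φ z = Dhat f c z + b z + pd 3 f z * c z := by
  have e := pd_congr 3 hU gx hz
  rw [pd_mul 3 (differentiableAt_of_contDiffOn hU hh hz)
    (differentiableAt_of_contDiffOn hU (contDiffOn_Dhat hU hf hφ) hz),
    pd_three_Dhat hU hf hg hz, pd_three_Dhat hU hf hφ hz, Dhat_congr hU gq hz,
    Dhat_congr hU φq hz, Dhat_const, gp z hz, gq z hz, φq z hz] at e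
  linear_combination -e

theorem pd_two_of_Dhat_eq_mul (hU : IsOpen U) (hf : ContDiffOn ℝ ∞ f U)
    (hφ : ContDiffOn ℝ ∞ φ U) (hg : ContDiffOn ℝ ∞ g U) (hh : ContDiffOn ℝ ∞ h U)
    (hb : ContDiffOn ℝ ∞ b U)
    (φq : ∀ z ∈ U, pd 3 φ z = 0) (gx : ∀ z ∈ U, Dhat f g z = h z * Dhat f φ z)
    (gu : ∀ z ∈ U, pd 1 g z = h z * pd 1 φ z + a z)
    (gp : ∀ z ∈ U, pd 2 g z = h z * pd 2 φ z + b z) (gq : ∀ z ∈ U, pd 3 g z = c z) (hz : z ∈ U) :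
    pd 2 h z * Dhat f φ z
      = Dhat f h z * pd 2 φ z + Dhat f b z + a z + pd 2 f z * c z := by
  have dh := differentiableAt_of_contDiffOn hU hh hz
  have dφ := differentiableAt_of_contDiffOn hU (contDiffOn_pd hU hφ 2) hz
  have e := pd_congr 2 hU gx hz
  rw [pd_mul 2 dh (differentiableAt_of_contDiffOn hU (contDiffOn_Dhat hU hf hφ) hz),
    pd_two_Dhat hU hf hg hz, pd_two_Dhat hU hf hφ hz, Dhat_congr hU gp hz,
    Dhat_add (dh.fun_mul dφ) (differentiableAt_of_contDiffOn hU hb hz), Dhat_mul dh dφ,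
    gu z hz, gq z hz, φq z hz] at e
  linear_combination -e

theorem pd_one_of_Dhat_eq_mul (hU : IsOpen U) (hf : ContDiffOn ℝ ∞ f U)
    (hφ : ContDiffOn ℝ ∞ φ U) (hg : ContDiffOn ℝ ∞ g U) (hh : ContDiffOn ℝ ∞ h U)
    (ha : ContDiffOn ℝ ∞ a U)
    (φq : ∀ z ∈ U, pd 3 φ z = 0) (gx : ∀ z ∈ U, Dhat f g z = h z * Dhat f φ z)
    (gu : ∀ z ∈ U, pd 1 g z = h z * pd 1 φ z + a z) (gq : ∀ z ∈ U, pd 3 g z = c z) (hz : z ∈ U) :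
    pd 1 h z * Dhat f φ z = Dhat f h z * pd 1 φ z + Dhat f a z + pd 1 f z * c z := by
  have dh := differentiableAt_of_contDiffOn hU hh hz
  have dφ := differentiableAt_of_contDiffOn hU (contDiffOn_pd hU hφ 1) hz
  have e := pd_congr 1 hU gx hz
  rw [pd_mul 1 dh (differentiableAt_of_contDiffOn hU (contDiffOn_Dhat hU hf hφ) hz),
    pd_one_Dhat hU hf hg hz, pd_one_Dhat hU hf hφ hz, Dhat_congr hU gu hz,
    Dhat_add (dh.fun_mul dφ) (differentiableAt_of_contDiffOn hU ha hz), Dhat_mul dh dφ,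
    gq z hz, φq z hz] at e
  linear_combination -e

end Step

/-- The equations on `U` satisfied by the components `φ, ψ, χ, η` of the prolongation of a contact
transformation with multiplier `l` into `u''' = s u' + u`, where `σ = -D_x φ` and
`m = D_x l / (l σ)`. -/
structure LiftedEquivalence (U : Set J2) (f : J2 → ℝ) (s : ℝ) (φ ψ χ η l σ m : J2 → ℝ) :
    Prop where
  isOpen : IsOpen U
  smooth_f : ContDiffOn ℝ ∞ f U
  smooth_φ : ContDiffOn ℝ ∞ φ U
  smooth_ψ : ContDiffOn ℝ ∞ ψ U
  smooth_χ : ContDiffOn ℝ ∞ χ U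
  smooth_η : ContDiffOn ℝ ∞ η U
  smooth_l : ContDiffOn ℝ ∞ l U
  smooth_σ : ContDiffOn ℝ ∞ σ U
  smooth_m : ContDiffOn ℝ ∞ m U
  σ_ne : ∀ z ∈ U, σ z ≠ 0
  l_ne : ∀ z ∈ U, l z ≠ 0
  φ_x : ∀ z ∈ U, Dhat f φ z = -σ z
  φ_q : ∀ z ∈ U, pd 3 φ z = 0
  ψ_x : ∀ z ∈ U, Dhat f ψ z = χ z * Dhat f φ z
  ψ_u : ∀ z ∈ U, pd 1 ψ z = χ z * pd 1 φ z + l z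
  ψ_p : ∀ z ∈ U, pd 2 ψ z = χ z * pd 2 φ z
  ψ_q : ∀ z ∈ U, pd 3 ψ z = 0
  χ_x : ∀ z ∈ U, Dhat f χ z = η z * Dhat f φ z
  χ_q : ∀ z ∈ U, pd 3 χ z = 0
  η_x : ∀ z ∈ U, Dhat f η z = (s * χ z + ψ z) * Dhat f φ z
  l_x : ∀ z ∈ U, Dhat f l z = m z * σ z * l z
  l_q : ∀ z ∈ U, pd 3 l z = 0

namespace LiftedEquivalence

variable {U : Set J2} {f : J2 → ℝ} {s : ℝ} {φ ψ χ η l σ m : J2 → ℝ}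
  (H : LiftedEquivalence U f s φ ψ χ η l σ m) {z : J2}
include H

theorem differentiableAt (hz : z ∈ U) {g : J2 → ℝ} (hg : ContDiffOn ℝ ∞ g U) :
    DifferentiableAt ℝ g z :=
  differentiableAt_of_contDiffOn H.isOpen hg hz

theorem smooth_I1 : ContDiffOn ℝ ∞ (I1 f) U :=
  (contDiffOn_pd H.isOpen H.smooth_f 3).neg

theorem smooth_I2 : ContDiffOn ℝ ∞ (I2 f) U :=
  ((contDiffOn_const.mul (H.smooth_I1.pow 2)).sub (contDiffOn_pd H.isOpen H.smooth_f 2)).sub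
    (contDiffOn_const.mul (contDiffOn_Dhat H.isOpen H.smooth_f H.smooth_I1))

theorem smooth_l_div_σ : ContDiffOn ℝ ∞ (fun z => l z / σ z) U :=
  H.smooth_l.div H.smooth_σ H.σ_ne

theorem χ_p : ∀ z ∈ U, pd 2 χ z = η z * pd 2 φ z + -(l z / σ z) := fun z hz => by
  -- Here b = c = 0, because dψ - χ dφ is a multiple of ω¹ alone.
  have e := pd_two_of_Dhat_eq_mul (b := fun _ => 0) (c := fun _ => 0) H.isOpen H.smooth_f
    H.smooth_φ H.smooth_ψ H.smooth_χ contDiffOn_const H.φ_q H.ψ_x H.ψ_u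
    (fun z hz => by simp [H.ψ_p z hz]) H.ψ_q hz
  rw [H.χ_x z hz, H.φ_x z hz, Dhat_const] at e
  have := H.σ_ne z hz
  field_simp
  linear_combination -e

theorem χ_u : ∀ z ∈ U, pd 1 χ z = η z * pd 1 φ z + -(m z * l z) := fun z hz => by
  have e := pd_one_of_Dhat_eq_mul (c := fun _ => 0) H.isOpen H.smooth_f
    H.smooth_φ H.smooth_ψ H.smooth_χ H.smooth_l H.φ_q H.ψ_x H.ψ_u H.ψ_q hz
  rw [H.χ_x z hz, H.φ_x z hz, H.l_x z hz] at e
  apply mul_left_cancel₀ (H.σ_ne z hz)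
  linear_combination -e

theorem η_q : ∀ z ∈ U, pd 3 η z = l z / σ z ^ 2 := fun z hz => by
  have e := pd_three_of_Dhat_eq_mul (c := fun _ => 0) H.isOpen H.smooth_f
    H.smooth_φ H.smooth_χ H.smooth_η H.φ_q H.χ_x H.χ_p H.χ_q hz
  rw [H.φ_x z hz, Dhat_const] at e
  have := H.σ_ne z hz
  field_simp at e ⊢
  linear_combination -e

theorem Dhat_l_div_σ (hz : z ∈ U) :
    Dhat f (fun z => l z / σ z) z = m z * l z - l z * Dhat f σ z / σ z ^ 2 := by
  have := H.σ_ne z hz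
  rw [Dhat_div (H.differentiableAt hz H.smooth_l) (H.differentiableAt hz H.smooth_σ) this,
    H.l_x z hz]
  field_simp

/-- A provisional form: the derivative of σ is still unknown, and is determined by `σ_x` from this
very formula. -/
theorem η_p_aux : ∀ z ∈ U, pd 2 η z = (s * χ z + ψ z) * pd 2 φ z +
    (2 * (m z * (l z / σ z)) - l z / σ z ^ 3 * Dhat f σ z) := fun z hz => by
  have e := pd_two_of_Dhat_eq_mul (c := fun _ => 0) H.isOpen H.smooth_f
    H.smooth_φ H.smooth_χ H.smooth_η H.smooth_l_div_σ.neg H.φ_q H.χ_x H.χ_u H.χ_p H.χ_q hz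
  rw [H.η_x z hz, H.φ_x z hz, Dhat_neg, H.Dhat_l_div_σ hz] at e
  have := H.σ_ne z hz
  field_simp at e ⊢
  linear_combination -e

theorem smooth_l_div_σ_pow (n : ℕ) : ContDiffOn ℝ ∞ (fun z => l z / σ z ^ n) U :=
  H.smooth_l.div (H.smooth_σ.pow n) fun z hz => pow_ne_zero n (H.σ_ne z hz)

theorem Dhat_l_div_σ_sq (hz : z ∈ U) : Dhat f (fun z => l z / σ z ^ 2) z
    = m z * l z / σ z - 2 * l z * Dhat f σ z / σ z ^ 3 := by
  have := H.σ_ne z hz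
  have e : Dhat f (fun z => l z / σ z ^ 2) z = Dhat f (fun z => l z / σ z / σ z) z := by
    congr 1
    ext z
    rw [div_div, sq]
  rw [e, Dhat_div (H.differentiableAt hz H.smooth_l_div_σ) (H.differentiableAt hz H.smooth_σ) this,
    H.Dhat_l_div_σ hz]
  field_simp
  ring

theorem smooth_canonicalRHS : ContDiffOn ℝ ∞ (fun z => s * χ z + ψ z) U :=
  (contDiffOn_const.mul H.smooth_χ).add H.smooth_ψ

theorem pd_canonicalRHS (i : Fin 4) (hz : z ∈ U) :
    pd i (fun z => s * χ z + ψ z) z = s * pd i χ z + pd i ψ z := by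
  rw [pd_add i ((H.differentiableAt hz H.smooth_χ).const_mul s) (H.differentiableAt hz H.smooth_ψ),
    pd_const_mul i s (H.differentiableAt hz H.smooth_χ)]

theorem Dhat_canonicalRHS (hz : z ∈ U) :
    Dhat f (fun z => s * χ z + ψ z) z = (s * η z + χ z) * Dhat f φ z := by
  rw [Dhat_add ((H.differentiableAt hz H.smooth_χ).const_mul s) (H.differentiableAt hz H.smooth_ψ),
    Dhat_const_mul s (H.differentiableAt hz H.smooth_χ), H.χ_x z hz, H.ψ_x z hz]
  ring

/-- The chain closes here: h = sχ + ψ does not depend on q, so the ∂_q identity is an equation among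
l, σ, m. Dividing out l leaves the formula that makes m equal to `I5`. -/
theorem σ_x : ∀ z ∈ U, Dhat f σ z = σ z * (m z * σ z - I1 f z / 3) := fun z hz => by
  have e := pd_three_of_Dhat_eq_mul H.isOpen H.smooth_f
    H.smooth_φ H.smooth_η H.smooth_canonicalRHS H.φ_q H.η_x H.η_p_aux H.η_q hz
  rw [H.pd_canonicalRHS 3 hz, H.χ_q z hz, H.ψ_q z hz, H.Dhat_l_div_σ_sq hz] at e
  have := H.σ_ne z hz
  have hl := H.l_ne z hz
  field_simp at e
  rw [I1]
  apply mul_left_cancel₀ hl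
  linear_combination e / 3

theorem η_p : ∀ z ∈ U, pd 2 η z = (s * χ z + ψ z) * pd 2 φ z +
    (m z * (l z / σ z) + I1 f z / 3 * (l z / σ z ^ 2)) := fun z hz => by
  rw [H.η_p_aux z hz, H.σ_x z hz]
  have := H.σ_ne z hz
  field_simp
  ring

/-- Again provisional: `m_x` will replace the derivative of m. -/
theorem η_u_aux : ∀ z ∈ U, pd 1 η z = (s * χ z + ψ z) * pd 1 φ z +
    (Dhat f m z * (l z / σ z) + m z ^ 2 * l z) := fun z hz => by
  have e := pd_one_of_Dhat_eq_mul (c := fun _ => 0) H.isOpen H.smooth_f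
    H.smooth_φ H.smooth_χ H.smooth_η (H.smooth_m.mul H.smooth_l).neg H.φ_q H.χ_x H.χ_u H.χ_q hz
  rw [H.η_x z hz, H.φ_x z hz, Dhat_neg, Dhat_mul (H.differentiableAt hz H.smooth_m)
    (H.differentiableAt hz H.smooth_l), H.l_x z hz] at e
  have := H.σ_ne z hz
  field_simp at e ⊢
  linear_combination -e

/-- The ∂_p identity for h = sχ + ψ. Modulo multiples of φ_p, the left side contributes only s l,
from χ_p; solving for the derivative of m is equivalent to `K` = s. -/
theorem m_x : ∀ z ∈ U, Dhat f m z = σ z * (s - m z ^ 2) / 2 + I2 f z / (2 * σ z) := fun z hz => by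
  have d1 := H.differentiableAt hz H.smooth_l_div_σ
  have d2 := H.differentiableAt hz (H.smooth_l_div_σ_pow 2)
  have dm := H.differentiableAt hz H.smooth_m
  have dI := H.differentiableAt hz H.smooth_I1
  have hI : ContDiffOn ℝ ∞ (fun z => I1 f z / 3) U := H.smooth_I1.div_const 3
  have eI : Dhat f (fun z => I1 f z / 3) z = Dhat f (I1 f) z / 3 := by
    rw [Dhat_div dI (differentiableAt_const 3) (by norm_num), Dhat_const]
    ring
  have e := pd_two_of_Dhat_eq_mul H.isOpen H.smooth_f H.smooth_φ H.smooth_η H.smooth_canonicalRHS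
    ((H.smooth_m.mul H.smooth_l_div_σ).add (hI.mul (H.smooth_l_div_σ_pow 2)))
    H.φ_q H.η_x H.η_u_aux H.η_p H.η_q hz
  rw [H.pd_canonicalRHS 2 hz, H.Dhat_canonicalRHS hz, H.χ_p z hz, H.ψ_p z hz,
    Dhat_add (dm.fun_mul d1) ((H.differentiableAt hz hI).fun_mul d2), Dhat_mul dm d1,
    Dhat_mul (H.differentiableAt hz hI) d2, eI, H.Dhat_l_div_σ hz, H.Dhat_l_div_σ_sq hz,
    H.σ_x z hz, H.φ_x z hz] at e
  have := H.σ_ne z hz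
  have hl := H.l_ne z hz
  rw [I2]
  field_simp at e ⊢
  apply mul_left_cancel₀ hl
  linear_combination -3 * e

theorem η_u : ∀ z ∈ U, pd 1 η z = (s * χ z + ψ z) * pd 1 φ z +
    ((s + m z ^ 2) / 2 * l z + I2 f z / 2 * (l z / σ z ^ 2)) := fun z hz => by
  rw [H.η_u_aux z hz, H.m_x z hz]
  have := H.σ_ne z hz
  field_simp
  ring

/-- The ∂_u identity for h = sχ + ψ. All terms in m cancel, and σ³ arises from the summand l of ψ_u,
that is, from the term ū of the canonical equation. -/
theorem I3_eq : ∀ z ∈ U, I3 f z = σ z ^ 3 := fun z hz => by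
  have d2 := H.differentiableAt hz (H.smooth_l_div_σ_pow 2)
  have dm := H.differentiableAt hz H.smooth_m
  have dl := H.differentiableAt hz H.smooth_l
  have hI : ContDiffOn ℝ ∞ (fun z => I2 f z / 2) U := H.smooth_I2.div_const 2
  have hM : ContDiffOn ℝ ∞ (fun z => (s + m z ^ 2) / 2) U :=
    (contDiffOn_const.add (H.smooth_m.pow 2)).div_const 2
  have eI : Dhat f (fun z => I2 f z / 2) z = Dhat f (I2 f) z / 2 := by
    rw [Dhat_div (H.differentiableAt hz H.smooth_I2) (differentiableAt_const 2) (by norm_num),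
      Dhat_const]
    ring
  have eM : Dhat f (fun z => (s + m z ^ 2) / 2) z = m z * Dhat f m z := by
    have : (fun z => (s + m z ^ 2) / 2) = fun z => s / 2 + 1 / 2 * (m z * m z) := by
      ext z
      ring
    rw [this, Dhat_add (differentiableAt_const _) ((dm.fun_mul dm).const_mul _), Dhat_const,
      Dhat_const_mul _ (dm.fun_mul dm), Dhat_mul dm dm]
    ring
  have e := pd_one_of_Dhat_eq_mul H.isOpen H.smooth_f H.smooth_φ H.smooth_η H.smooth_canonicalRHS
    ((hM.mul H.smooth_l).add (hI.mul (H.smooth_l_div_σ_pow 2)))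
    H.φ_q H.η_x H.η_u H.η_q hz
  rw [H.pd_canonicalRHS 1 hz, H.Dhat_canonicalRHS hz, H.χ_u z hz, H.ψ_u z hz,
    Dhat_add ((H.differentiableAt hz hM).fun_mul dl) ((H.differentiableAt hz hI).fun_mul d2),
    Dhat_mul (H.differentiableAt hz hM) dl,
    Dhat_mul (H.differentiableAt hz hI) d2, eI, eM, H.Dhat_l_div_σ_sq hz,
    H.l_x z hz, H.m_x z hz, H.σ_x z hz, H.φ_x z hz] at e
  have := H.σ_ne z hz
  have hl := H.l_ne z hz
  rw [I3]
  field_simp at e ⊢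
  apply mul_left_cancel₀ hl
  linear_combination e

/-- For a function g independent of q the commutator [∂_q, D̂] g reduces to g_p. The same remark
gives `l_p`. -/
theorem φ_p : ∀ z ∈ U, pd 2 φ z = -pd 3 σ z := fun z hz => by
  have e := pd_congr 3 H.isOpen H.φ_x hz
  rw [pd_three_Dhat H.isOpen H.smooth_f H.smooth_φ hz, Dhat_congr H.isOpen H.φ_q hz, Dhat_const,
    H.φ_q z hz, pd_neg] at e
  linear_combination e

theorem l_p : ∀ z ∈ U, pd 2 l z = (pd 3 m z * σ z + m z * pd 3 σ z) * l z := fun z hz => by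
  have dm := H.differentiableAt hz H.smooth_m
  have dσ := H.differentiableAt hz H.smooth_σ
  have e := pd_congr 3 H.isOpen H.l_x hz
  rw [pd_three_Dhat H.isOpen H.smooth_f H.smooth_l hz, Dhat_congr H.isOpen H.l_q hz, Dhat_const,
    H.l_q z hz, pd_mul 3 (dm.fun_mul dσ) (H.differentiableAt hz H.smooth_l), pd_mul 3 dm dσ,
    H.l_q z hz] at e
  linear_combination e

/-- Compatibility ψ_up = ψ_pu: the second derivatives of φ cancel, and with l_p known the equation
determines φ_u. -/
theorem φ_u : ∀ z ∈ U, pd 1 φ z = pd 3 m z * σ z ^ 2 := fun z hz => by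
  have dφ := fun i => H.differentiableAt hz (contDiffOn_pd H.isOpen H.smooth_φ i)
  have dχ := H.differentiableAt hz H.smooth_χ
  have e : pd 2 (pd 1 ψ) z = pd 1 (pd 2 ψ) z :=
    pd_comm (H.smooth_ψ.contDiffAt (H.isOpen.mem_nhds hz)) 2 1
  rw [pd_congr 2 H.isOpen H.ψ_u hz, pd_congr 1 H.isOpen H.ψ_p hz, pd_mul 1 dχ (dφ 2),
    pd_add 2 (dχ.fun_mul (dφ 1)) (H.differentiableAt hz H.smooth_l), pd_mul 2 dχ (dφ 1),
    pd_comm (H.smooth_φ.contDiffAt (H.isOpen.mem_nhds hz)) 2 1, H.l_p z hz, H.χ_p z hz,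
    H.χ_u z hz, H.φ_p z hz] at e
  have := H.σ_ne z hz
  have hl := H.l_ne z hz
  field_simp at e
  apply mul_left_cancel₀ hl
  linear_combination -e

/-- Compatibility χ_up = χ_pu, solved for l_u, which enters through the term -l/σ of χ_p. -/
theorem l_u : ∀ z ∈ U, pd 1 l z = (σ z * pd 2 m z + pd 1 σ z / σ z
    - I1 f z * pd 3 m z * σ z / 3 - pd 3 σ z * Dhat f m z) * l z := fun z hz => by
  have dφ := fun i => H.differentiableAt hz (contDiffOn_pd H.isOpen H.smooth_φ i)
  have dη := H.differentiableAt hz H.smooth_η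
  have dm := H.differentiableAt hz H.smooth_m
  have dl := H.differentiableAt hz H.smooth_l
  have hσ := H.σ_ne z hz
  have e : pd 2 (pd 1 χ) z = pd 1 (pd 2 χ) z :=
    pd_comm (H.smooth_χ.contDiffAt (H.isOpen.mem_nhds hz)) 2 1
  rw [pd_congr 2 H.isOpen H.χ_u hz, pd_congr 1 H.isOpen H.χ_p hz,
    pd_add 1 (dη.fun_mul (dφ 2)) (H.differentiableAt hz H.smooth_l_div_σ.neg),
    pd_mul 1 dη (dφ 2), pd_neg, pd_div 1 dl (H.differentiableAt hz H.smooth_σ) hσ,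
    pd_add 2 (dη.fun_mul (dφ 1)) (dm.fun_mul dl).fun_neg, pd_mul 2 dη (dφ 1), pd_neg,
    pd_mul 2 dm dl,
    pd_comm (H.smooth_φ.contDiffAt (H.isOpen.mem_nhds hz)) 2 1, H.l_p z hz, H.η_p z hz,
    H.η_u_aux z hz, H.φ_p z hz, H.φ_u z hz] at e
  field_simp at e ⊢
  linear_combination e

end LiftedEquivalence

theorem cbrt_pow (t : ℝ) : cbrt (t ^ 3) = t :=
  (Odd.strictMono_pow (by decide : Odd 3)).injective (cbrt_pow_three (t ^ 3))

/-! ### The invariants of a linearizable equation -/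

namespace LiftedEquivalence

variable {U : Set J2} {f : J2 → ℝ} {s : ℝ} {φ ψ χ η l σ m : J2 → ℝ}
  (H : LiftedEquivalence U f s φ ψ χ η l σ m) {z : J2}
include H

theorem J3_eq : ∀ z ∈ U, J3 f z = σ z := fun z hz => by
  rw [J3, H.I3_eq z hz, cbrt_pow]

theorem I4_eq : ∀ z ∈ U, I4 f z = pd 3 σ z := fun _ hz => pd_congr 3 H.isOpen H.J3_eq hz

theorem I5_eq : ∀ z ∈ U, I5 f z = m z := fun z hz => by
  rw [I5, Dhat_congr H.isOpen H.J3_eq hz, H.J3_eq z hz, H.σ_x z hz]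
  have := H.σ_ne z hz
  field_simp
  ring

theorem I7_eq : ∀ z ∈ U, I7 f z = -pd 3 m z * σ z ^ 2 := fun z hz => by
  rw [I7, pd_congr 3 H.isOpen H.I5_eq hz, H.J3_eq z hz]

theorem K_eq : ∀ z ∈ U, K f z = s := fun z hz => by
  rw [K, I9, Dhat_congr H.isOpen H.I5_eq hz, H.I5_eq z hz, H.J3_eq z hz, H.m_x z hz]
  have := H.σ_ne z hz
  field_simp
  ring

theorem Q_eq : ∀ z ∈ U, Q f z = -(σ z * pd 2 m z + pd 1 σ z / σ z
    - I1 f z * pd 3 m z * σ z / 3 - pd 3 σ z * Dhat f m z) := fun z hz => by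
  rw [Q, Dhat_congr H.isOpen H.I5_eq hz, pd_congr 2 H.isOpen H.I5_eq hz,
    pd_congr 1 H.isOpen H.J3_eq hz, H.I7_eq z hz, H.I4_eq z hz, H.J3_eq z hz]
  have := H.σ_ne z hz
  field_simp
  ring

end LiftedEquivalence

/-! ### Contact transformations and their prolongations in coordinates -/

section Coordinates

variable {φ ψ χ lam : J1 → ℝ} {z : J2}

theorem contact_iff (hφ : DifferentiableAt ℝ φ (proj z)) (hψ : DifferentiableAt ℝ ψ (proj z)) :
    fderiv ℝ ψ (proj z) - χ (proj z) • fderiv ℝ φ (proj z) =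
      lam (proj z) • ((ContinuousLinearMap.proj 1 : J1 →L[ℝ] ℝ) -
        proj z 2 • (ContinuousLinearMap.proj 0 : J1 →L[ℝ] ℝ)) ↔
    pd 0 (lift ψ) z = lift χ z * pd 0 (lift φ) z - z 2 * lift lam z ∧
    pd 1 (lift ψ) z = lift χ z * pd 1 (lift φ) z + lift lam z ∧
    pd 2 (lift ψ) z = lift χ z * pd 2 (lift φ) z := by
  have hp : proj z 2 = z 2 := rfl
  rw [pd_lift_zero hφ, pd_lift_one hφ, pd_lift_two hφ, pd_lift_zero hψ, pd_lift_one hψ,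
    pd_lift_two hψ, lift, lift, hp]
  constructor
  · intro h
    have h0 := congrArg (fun L : J1 →L[ℝ] ℝ => L (Pi.single 0 1)) h
    have h1 := congrArg (fun L : J1 →L[ℝ] ℝ => L (Pi.single 1 1)) h
    have h2 := congrArg (fun L : J1 →L[ℝ] ℝ => L (Pi.single 2 1)) h
    simp at h0 h1 h2
    simp only [pd]
    exact ⟨by linear_combination h0, by linear_combination h1, by linear_combination h2⟩
  · rintro ⟨h0, h1, h2⟩
    ext w
    simp only [sub_apply, smul_apply, smul_eq_mul,
      ContinuousLinearMap.proj_apply]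
    rw [fderiv_apply_eq_sum, fderiv_apply_eq_sum, Fin.sum_univ_three, Fin.sum_univ_three, h0, h1,
      h2]
    ring

theorem det_jacobian (hφ : DifferentiableAt ℝ φ (proj z)) (hψ : DifferentiableAt ℝ ψ (proj z))
    (hχ : DifferentiableAt ℝ χ (proj z)) :
    (fderiv ℝ (fun w : J1 => ![φ w, ψ w, χ w]) (proj z)).det =
      (!![pd 0 (lift φ) z, pd 1 (lift φ) z, pd 2 (lift φ) z;
          pd 0 (lift ψ) z, pd 1 (lift ψ) z, pd 2 (lift ψ) z;
          pd 0 (lift χ) z, pd 1 (lift χ) z, pd 2 (lift χ) z] : Matrix (Fin 3) (Fin 3) ℝ).det := by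
  have h : HasFDerivAt (fun w : J1 => ![φ w, ψ w, χ w])
      (ContinuousLinearMap.pi ![fderiv ℝ φ (proj z), fderiv ℝ ψ (proj z), fderiv ℝ χ (proj z)])
      (proj z) := by
    rw [hasFDerivAt_pi']
    intro i
    fin_cases i
    exacts [hφ.hasFDerivAt, hψ.hasFDerivAt, hχ.hasFDerivAt]
  rw [h.fderiv, ContinuousLinearMap.det, ← LinearMap.det_toMatrix']
  congr 1
  ext i j
  rw [LinearMap.toMatrix'_apply, pd_lift_zero hφ, pd_lift_one hφ, pd_lift_two hφ,
    pd_lift_zero hψ, pd_lift_one hψ, pd_lift_two hψ, pd_lift_zero hχ, pd_lift_one hχ,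
    pd_lift_two hχ]
  fin_cases i <;> fin_cases j <;> simp [pd]

theorem fderiv_prolong_apply (hφ : DifferentiableAt ℝ (lift φ) z)
    (hψ : DifferentiableAt ℝ (lift ψ) z) (hχ : DifferentiableAt ℝ (lift χ) z)
    (hη : DifferentiableAt ℝ (prolongQ φ χ) z) (w : J2) :
    fderiv ℝ (prolong φ ψ χ) z w = ![fderiv ℝ (lift φ) z w, fderiv ℝ (lift ψ) z w,
      fderiv ℝ (lift χ) z w, fderiv ℝ (prolongQ φ χ) z w] := by
  have h : HasFDerivAt (prolong φ ψ χ)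
      (ContinuousLinearMap.pi ![fderiv ℝ (lift φ) z, fderiv ℝ (lift ψ) z, fderiv ℝ (lift χ) z,
        fderiv ℝ (prolongQ φ χ) z]) z := by
    rw [hasFDerivAt_pi']
    intro i
    fin_cases i
    exacts [hφ.hasFDerivAt, hψ.hasFDerivAt, hχ.hasFDerivAt, hη.hasFDerivAt]
  rw [h.fderiv]
  ext i
  fin_cases i <;> simp

theorem coframe_apply (f : J2 → ℝ) (z w : J2) (i : Fin 4) : coframe f z i w =
    ![w 1 - z 2 * w 0, w 2 - z 3 * w 0, w 3 - f z * w 0, w 0] i := by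
  fin_cases i <;> simp [coframe]

end Coordinates

/-! ### From a contact equivalence to the equations for its components on U -/

section Equivalence

variable {U : Set J2} {f : J2 → ℝ} {s : ℝ} {φ ψ χ lam : J1 → ℝ}

theorem contDiffOn_prolongQ (hU : IsOpen U) (hφ : ContDiffOn ℝ ∞ φ (proj '' U))
    (hχ : ContDiffOn ℝ ∞ χ (proj '' U)) (h0 : ∀ z ∈ U, Dx (lift φ) z ≠ 0) :
    ContDiffOn ℝ ∞ (prolongQ φ χ) U :=
  (contDiffOn_Dx hU (contDiffOn_lift hχ)).div (contDiffOn_Dx hU (contDiffOn_lift hφ)) h0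

/-- The multiplier of a contact transformation is smooth. -/
theorem IsContactTransformation.smooth_lam {V : Set J1} (hV : IsOpen V)
    (h : IsContactTransformation V φ ψ χ lam) : ContDiffOn ℝ ∞ lam V := by
  have e : ∀ v ∈ V, lam v = pd 1 ψ v - χ v * pd 1 φ v := fun v hv => by
    have := congrArg (fun L : J1 →L[ℝ] ℝ => L (Pi.single 1 1)) (h.contact v hv)
    simp at this
    simp only [pd]
    linear_combination -this
  exact ((contDiffOn_pd hV h.smooth_ψ 1).sub (h.smooth_χ.mul (contDiffOn_pd hV h.smooth_φ 1))).congr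
    e

namespace IsContactEquivalence

variable (hU : IsOpen U) (h : IsContactEquivalence U f (canonicalRHS s) φ ψ χ lam)
include hU h

theorem fderiv_prolong (z : J2) (hz : z ∈ U) (w : J2) :
    fderiv ℝ (prolong φ ψ χ) z w = ![fderiv ℝ (lift φ) z w, fderiv ℝ (lift ψ) z w,
      fderiv ℝ (lift χ) z w, fderiv ℝ (prolongQ φ χ) z w] := by
  have hc := h.contactTransformation
  exact fderiv_prolong_apply
    (differentiableAt_of_contDiffOn hU (contDiffOn_lift hc.smooth_φ) hz)
    (differentiableAt_of_contDiffOn hU (contDiffOn_lift hc.smooth_ψ) hz)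
    (differentiableAt_of_contDiffOn hU (contDiffOn_lift hc.smooth_χ) hz)
    (differentiableAt_of_contDiffOn hU
      (contDiffOn_prolongQ hU hc.smooth_φ hc.smooth_χ h.prolongable) hz) w

theorem contact_coordinates (z : J2) (hz : z ∈ U) :
    pd 0 (lift ψ) z = lift χ z * pd 0 (lift φ) z - z 2 * lift lam z ∧
    pd 1 (lift ψ) z = lift χ z * pd 1 (lift φ) z + lift lam z ∧
    pd 2 (lift ψ) z = lift χ z * pd 2 (lift φ) z :=
  (contact_iff (differentiableAt_of_mem_image_proj hU h.contactTransformation.smooth_φ hz)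
    (differentiableAt_of_mem_image_proj hU h.contactTransformation.smooth_ψ hz)).1
    (h.contactTransformation.contact _ (Set.mem_image_of_mem _ hz))

/-- Evaluating the first row of the pullback on ∂_u identifies λ with the entry a1 of the structure
group, which cannot vanish. -/
theorem lift_lam_ne_zero (z : J2) (hz : z ∈ U) : lift lam z ≠ 0 := by
  obtain ⟨A, ⟨a1, a2, a3, a4, a5, a6, a7, a8, a9, hne, rfl⟩, hA⟩ := h.pullback z hz
  have e := congrArg (fun L : J2 →L[ℝ] ℝ => L (Pi.single 1 1)) (hA 0)
  simp only [ContinuousLinearMap.comp_apply, Fin.sum_univ_four, add_apply,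
    smul_apply, coframe_apply, h.fderiv_prolong hU z hz] at e
  simp [prolong] at e
  have e1 := (h.contact_coordinates hU z hz).2.1
  rw [pd, pd] at e1
  have : lift lam z = a1 := by linear_combination e - e1
  rw [this]
  rintro rfl
  simp at hne

/-- The total field is annihilated by ω¹, ω², ω³, and the third row of the structure group has no ω⁴
entry, so the pullback of dq̄ - f̄ dx̄ vanishes on it. -/
theorem Dhat_prolongQ (z : J2) (hz : z ∈ U) : Dhat f (prolongQ φ χ) z =
    (s * lift χ z + lift ψ z) * Dhat f (lift φ) z := by
  obtain ⟨A, ⟨a1, a2, a3, a4, a5, a6, a7, a8, a9, hne, rfl⟩, hA⟩ := h.pullback z hz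
  have e := congrArg (fun L : J2 →L[ℝ] ℝ => L (totalField f z)) (hA 2)
  simp only [ContinuousLinearMap.comp_apply, Fin.sum_univ_four, add_apply,
    smul_apply, coframe_apply, h.fderiv_prolong hU z hz] at e
  simp [prolong, canonicalRHS, totalField] at e
  simp only [Dhat_eq_dirDeriv, dirDeriv, totalField]
  linear_combination e

theorem liftedEquivalence (hf : ContDiffOn ℝ ∞ f U) :
    LiftedEquivalence U f s (lift φ) (lift ψ) (lift χ) (prolongQ φ χ) (lift lam)
      (fun z => -Dhat f (lift φ) z)
      (fun z => Dhat f (lift lam) z / (-Dhat f (lift φ) z * lift lam z)) := by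
  have hc := h.contactTransformation
  have hl := hc.smooth_lam (isOpen_image_proj hU)
  have hσ : ∀ z ∈ U, -Dhat f (lift φ) z ≠ 0 := fun z hz => by
    rw [Dhat_lift f hU hc.smooth_φ hz]
    exact neg_ne_zero.2 (h.prolongable z hz)
  have sφ := contDiffOn_lift hc.smooth_φ
  have sσ := (contDiffOn_Dhat hU hf sφ).neg
  have sl := contDiffOn_lift hl
  exact
  { isOpen := hU
    smooth_f := hf
    smooth_φ := sφ
    smooth_ψ := contDiffOn_lift hc.smooth_ψ
    smooth_χ := contDiffOn_lift hc.smooth_χ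
    smooth_η := contDiffOn_prolongQ hU hc.smooth_φ hc.smooth_χ h.prolongable
    smooth_l := sl
    smooth_σ := sσ
    smooth_m := (contDiffOn_Dhat hU hf sl).div (sσ.mul sl)
      fun z hz => mul_ne_zero (hσ z hz) (h.lift_lam_ne_zero hU z hz)
    σ_ne := hσ
    l_ne := h.lift_lam_ne_zero hU
    φ_x := fun z _ => (neg_neg _).symm
    φ_q := fun z hz => pd_three_lift hU hc.smooth_φ hz
    ψ_x := fun z hz => by
      obtain ⟨e0, e1, e2⟩ := h.contact_coordinates hU z hz
      rw [Dhat_lift f hU hc.smooth_φ hz, Dhat_lift f hU hc.smooth_ψ hz, Dx, Dx, e0, e1, e2]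
      ring
    ψ_u := fun z hz => (h.contact_coordinates hU z hz).2.1
    ψ_p := fun z hz => (h.contact_coordinates hU z hz).2.2
    ψ_q := fun z hz => pd_three_lift hU hc.smooth_ψ hz
    χ_x := fun z hz => by
      rw [Dhat_lift f hU hc.smooth_φ hz, Dhat_lift f hU hc.smooth_χ hz, prolongQ,
        div_mul_cancel₀ _ (h.prolongable z hz)]
    χ_q := fun z hz => pd_three_lift hU hc.smooth_χ hz
    η_x := h.Dhat_prolongQ hU
    l_x := fun z hz => by
      have := neg_ne_zero.1 (hσ z hz)
      have := h.lift_lam_ne_zero hU z hz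
      field_simp
    l_q := fun z hz => pd_three_lift hU hl hz }

end IsContactEquivalence

end Equivalence

/-! ### The three linear systems -/

section Solved

variable {U : Set J2} {f : J2 → ℝ} {s : ℝ} {φ ψ χ lam : J1 → ℝ}

namespace IsContactEquivalence

variable (hU : IsOpen U) (hf : ContDiffOn ℝ ∞ f U)
  (h : IsContactEquivalence U f (canonicalRHS s) φ ψ χ lam)
include hU hf h

theorem J3_ne_zero : ∀ z ∈ U, J3 f z ≠ 0 := fun z hz => by
  have H := h.liftedEquivalence hU hf
  rw [H.J3_eq z hz]
  exact H.σ_ne z hz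

theorem stepOne : StepOne U f lam := by
  have H := h.liftedEquivalence hU hf
  exact
  { smooth := h.contactTransformation.smooth_lam (isOpen_image_proj hU)
    a1_x := fun z hz => by
      have e := H.l_x z hz
      rw [← H.I5_eq z hz, ← H.J3_eq z hz] at e
      rw [← Dhat_lift f hU
        (h.contactTransformation.smooth_lam (isOpen_image_proj hU)) hz, e]
      ring
    a1_u := fun z hz => by
      rw [H.l_u z hz, H.Q_eq z hz, neg_neg]
    a1_p := fun z hz => by
      rw [H.l_p z hz, H.J3_eq z hz, H.I5_eq z hz, H.I7_eq z hz, H.I4_eq z hz]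
      have := H.σ_ne z hz
      generalize -Dhat f (lift φ) z = S at *
      field_simp
      ring
    a1_q := H.l_q }

theorem stepTwo : StepTwo U f φ := by
  have H := h.liftedEquivalence hU hf
  exact
  { smooth := h.contactTransformation.smooth_φ
    φ_x := fun z hz => by rw [H.φ_x z hz, H.J3_eq z hz]
    φ_u := fun z hz => by
      rw [H.φ_u z hz, H.I7_eq z hz]
      ring
    φ_p := fun z hz => by rw [H.φ_p z hz, H.I4_eq z hz] }

theorem stepThree : StepThree U f s lam φ (prolongQ φ χ) χ ψ := by
  have H := h.liftedEquivalence hU hf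
  have T := h.stepTwo hU hf
  have hJ := h.J3_ne_zero hU hf
  exact
  { smooth_η := H.smooth_η
    smooth_χ := h.contactTransformation.smooth_χ
    smooth_ψ := h.contactTransformation.smooth_ψ
    η_x := fun z hz => by
      rw [H.η_x z hz, T.φ_x z hz]
      ring
    η_u := fun z hz => by
      rw [H.η_u z hz, T.φ_u z hz, ← H.I5_eq z hz, ← H.J3_eq z hz]
      have := hJ z hz
      field_simp
      ring
    η_p := fun z hz => by
      rw [H.η_p z hz, T.φ_p z hz, ← H.I5_eq z hz, ← H.J3_eq z hz]
      have := hJ z hz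
      field_simp
      ring
    η_q := fun z hz => by rw [H.η_q z hz, ← H.J3_eq z hz]
    χ_x := fun z hz => by
      rw [H.χ_x z hz, T.φ_x z hz]
      ring
    χ_u := fun z hz => by
      rw [H.χ_u z hz, T.φ_u z hz, ← H.I5_eq z hz]
      ring
    χ_p := fun z hz => by
      rw [H.χ_p z hz, T.φ_p z hz, ← H.J3_eq z hz]
      ring
    ψ_u := fun z hz => by
      rw [H.ψ_x z hz, H.ψ_u z hz, T.φ_x z hz, T.φ_u z hz]
      ring
    ψ_x := fun z hz => (h.contact_coordinates hU z hz).1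
    ψ_p := fun z hz => by
      rw [H.ψ_p z hz, T.φ_p z hz]
      ring
    χ_eq := fun z hz => by
      rw [H.ψ_x z hz, T.φ_x z hz, mul_div_cancel_right₀ _ (neg_ne_zero.2 (hJ z hz))]
    η_eq := fun z hz => by
      rw [H.χ_x z hz, T.φ_x z hz, mul_div_cancel_right₀ _ (neg_ne_zero.2 (hJ z hz))] }

end IsContactEquivalence

end Solved

/-! ### Comparison of solutions of the three systems -/

section Uniqueness

variable {U : Set J2} {f : J2 → ℝ} {s : ℝ}

theorem Dhat_eq_zero_of_pd {g : J2 → ℝ} {z : J2} (h : ∀ i, pd i g z = 0) : Dhat f g z = 0 := by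
  simp [Dhat, Dx, h]

/-- The quotient of two solutions of the first system is locally constant. -/
theorem StepOne.pd_div_eq_zero {a1 lam : J1 → ℝ} (hU : IsOpen U) (ha : StepOne U f a1)
    (hl : StepOne U f lam) (h0 : ∀ z ∈ U, lift lam z ≠ 0) :
    ∀ z ∈ U, ∀ i, pd i (lift fun v => a1 v / lam v) z = 0 := by
  intro z hz i
  have e : pd i (lift fun v => a1 v / lam v) z =
      (pd i (lift a1) z * lift lam z - lift a1 z * pd i (lift lam) z) / lift lam z ^ 2 :=
    pd_div i (differentiableAt_of_contDiffOn hU (contDiffOn_lift ha.smooth) hz)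
      (differentiableAt_of_contDiffOn hU (contDiffOn_lift hl.smooth) hz) (h0 z hz)
  rw [e]
  apply div_eq_zero_iff.2 (Or.inl _)
  have a0 := ha.a1_x z hz
  have l0 := hl.a1_x z hz
  -- The system prescribes the total derivative; removing the known u- and p-parts leaves ∂_x, with
  -- the same coefficient for both solutions.
  rw [Dx, ha.a1_u z hz, ha.a1_p z hz] at a0
  rw [Dx, hl.a1_u z hz, hl.a1_p z hz] at l0
  fin_cases i
  · simp only [Fin.zero_eta]
    linear_combination lift lam z * a0 - lift a1 z * l0
  · simp only [Fin.mk_one]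
    rw [ha.a1_u z hz, hl.a1_u z hz]
    ring
  · simp only [Fin.reduceFinMk]
    rw [ha.a1_p z hz, hl.a1_p z hz]
    ring
  · simp only [Fin.reduceFinMk]
    rw [ha.a1_q z hz, hl.a1_q z hz]
    ring

theorem StepTwo.pd_zero {φ : J1 → ℝ} (hU : IsOpen U) (h : StepTwo U f φ) {z : J2} (hz : z ∈ U) :
    pd 0 (lift φ) z = -J3 f z + z 2 * I7 f z + z 3 * I4 f z := by
  have e := h.φ_x z hz
  rw [Dhat_lift f hU h.smooth hz, Dx, h.φ_u z hz, h.φ_p z hz] at e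
  linear_combination e

/-- The third system is linear over locally constant functions, and it depends on `φ` only
through the derivatives of `φ`. -/
theorem StepThree.lift_mul {lam φ φ' c χ ψ : J1 → ℝ} {η : J2 → ℝ} (hU : IsOpen U)
    (hφ : StepTwo U f φ) (hφ' : StepTwo U f φ') (h : StepThree U f s lam φ η χ ψ)
    (hc : ContDiffOn ℝ ∞ c (proj '' U)) (c0 : ∀ z ∈ U, ∀ i, pd i (lift c) z = 0) :
    StepThree U f s (fun v => c v * lam v) φ' (fun z => lift c z * η z) (fun v => c v * χ v)
      (fun v => c v * ψ v) := by
  have sc := contDiffOn_lift hc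
  have P : ∀ g, ContDiffOn ℝ ∞ g U → ∀ z ∈ U, ∀ i,
      pd i (fun z => lift c z * g z) z = lift c z * pd i g z := fun g hg z hz i => by
    rw [pd_mul i (differentiableAt_of_contDiffOn hU sc hz)
      (differentiableAt_of_contDiffOn hU hg hz), c0 z hz i, zero_mul, zero_add]
  have D : ∀ g, ContDiffOn ℝ ∞ g U → ∀ z ∈ U,
      Dhat f (fun z => lift c z * g z) z = lift c z * Dhat f g z := fun g hg z hz => by
    rw [Dhat_mul (differentiableAt_of_contDiffOn hU sc hz)
      (differentiableAt_of_contDiffOn hU hg hz), Dhat_eq_zero_of_pd (c0 z hz), zero_mul, zero_add]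
  have L : ∀ g : J1 → ℝ, lift (fun v => c v * g v) = fun z => lift c z * lift g z :=
    fun _ => rfl
  have sη := h.smooth_η
  have sχ := contDiffOn_lift h.smooth_χ
  have sψ := contDiffOn_lift h.smooth_ψ
  refine ⟨sc.mul sη, hc.mul h.smooth_χ, hc.mul h.smooth_ψ, ?_, ?_, ?_, ?_, ?_, ?_, ?_, ?_, ?_, ?_,
    ?_, ?_⟩ <;> intro z hz <;> simp only [L]
  · rw [D _ sη z hz, h.η_x z hz]
    ring
  · rw [P _ sη z hz, h.η_u z hz]
    ring
  · rw [P _ sη z hz, h.η_p z hz]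
    ring
  · rw [P _ sη z hz, h.η_q z hz]
    ring
  · rw [D _ sχ z hz, h.χ_x z hz]
    ring
  · rw [P _ sχ z hz, h.χ_u z hz]
    ring
  · rw [P _ sχ z hz, h.χ_p z hz]
    ring
  · rw [D _ sψ z hz, P _ sψ z hz]
    linear_combination lift c z * h.ψ_u z hz
  · rw [P _ sψ z hz, h.ψ_x z hz, hφ.pd_zero hU hz, hφ'.pd_zero hU hz]
    ring
  · rw [P _ sψ z hz, h.ψ_p z hz]
    ring
  -- The denominators for φ and φ' are both -`J3`, so the quotients scale by c.
  · have e := h.χ_eq z hz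
    rw [hφ.φ_x z hz] at e
    rw [D _ sψ z hz, hφ'.φ_x z hz, mul_div_assoc, ← e]
  · have e := h.η_eq z hz
    rw [hφ.φ_x z hz] at e
    rw [D _ sχ z hz, hφ'.φ_x z hz, mul_div_assoc, ← e]

end Uniqueness

/-! ### Solutions of the systems are linearizing contact transformations -/

section Outcome

variable {U : Set J2} {f : J2 → ℝ} {s : ℝ} {a1 φ χ ψ : J1 → ℝ} {η : J2 → ℝ}

theorem StepThree.eq_prolongQ (hU : IsOpen U) (hφ : StepTwo U f φ)
    (h : StepThree U f s a1 φ η χ ψ) : ∀ z ∈ U, η z = prolongQ φ χ z := fun z hz => by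
  rw [h.η_eq z hz, prolongQ, Dhat_lift f hU hφ.smooth hz, Dhat_lift f hU h.smooth_χ hz]

/-- Substituting D̂ψ = -`J3` χ into the equation `ψ_u` and cancelling `J3` gives the du-component of
the contact condition. -/
theorem StepThree.ψ_contact (hJ : ∀ z ∈ U, J3 f z ≠ 0) (hφ : StepTwo U f φ)
    (h : StepThree U f s a1 φ η χ ψ) : ∀ z ∈ U,
    pd 1 (lift ψ) z = lift χ z * pd 1 (lift φ) z + lift a1 z := fun z hz => by
  have hz0 := hJ z hz
  have e := h.χ_eq z hz
  rw [hφ.φ_x z hz, eq_div_iff (neg_ne_zero.2 hz0)] at e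
  have e1 := h.ψ_u z hz
  rw [hφ.φ_u z hz]
  apply mul_left_cancel₀ hz0
  linear_combination -e1 - I7 f z * e

theorem StepThree.isContactTransformation (hU : IsOpen U) (hJ : ∀ z ∈ U, J3 f z ≠ 0)
    (h0 : ∀ v ∈ proj '' U, a1 v ≠ 0) (hφ : StepTwo U f φ)
    (h : StepThree U f s a1 φ η χ ψ) : IsContactTransformation (proj '' U) φ ψ χ a1 where
  smooth_φ := hφ.smooth
  smooth_ψ := h.smooth_ψ
  smooth_χ := h.smooth_χ
  contact := by
    rintro _ ⟨z, hz, rfl⟩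
    refine (contact_iff (differentiableAt_of_mem_image_proj hU hφ.smooth hz)
      (differentiableAt_of_mem_image_proj hU h.smooth_ψ hz)).2
      ⟨h.ψ_x z hz, h.ψ_contact hJ hφ z hz, ?_⟩
    rw [h.ψ_p z hz, hφ.φ_p z hz]
    ring
  jacobian := by
    rintro _ ⟨z, hz, rfl⟩
    have hz0 := hJ z hz
    have e := h.χ_x z hz
    rw [Dhat_lift f hU h.smooth_χ hz, Dx] at e
    have e0 : pd 0 (lift χ) z = -J3 f z * η z - z 2 * pd 1 (lift χ) z - z 3 * pd 2 (lift χ) z := by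
      linear_combination e
    have ea : lift a1 z ≠ 0 := h0 _ (Set.mem_image_of_mem _ hz)
    rw [det_jacobian (differentiableAt_of_mem_image_proj hU hφ.smooth hz)
      (differentiableAt_of_mem_image_proj hU h.smooth_ψ hz)
      (differentiableAt_of_mem_image_proj hU h.smooth_χ hz), e0, h.ψ_x z hz,
      h.ψ_contact hJ hφ z hz, h.ψ_p z hz, h.χ_u z hz, h.χ_p z hz, hφ.pd_zero hU hz, hφ.φ_u z hz,
      hφ.φ_p z hz, Matrix.det_fin_three]
    -- The value a1² is seen from dφ ∧ dψ ∧ dχ = (-J3 ω⁴) ∧ (a1 ω¹) ∧ (-(a1/J3) ω²): modulo dφ, dψ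
    -- is a1 ω¹, and modulo dφ and ω¹, dχ is -(a1/J3) ω².
    refine ne_of_eq_of_ne (b := lift a1 z ^ 2) ?_ (pow_ne_zero 2 ea)
    simp
    field_simp
    ring

theorem StepThree.isContactEquivalence (hU : IsOpen U) (hJ : ∀ z ∈ U, J3 f z ≠ 0)
    (h0 : ∀ v ∈ proj '' U, a1 v ≠ 0) (hφ : StepTwo U f φ)
    (h : StepThree U f s a1 φ η χ ψ) :
    IsContactEquivalence U f (canonicalRHS s) φ ψ χ a1 where
  contactTransformation := h.isContactTransformation hU hJ h0 hφ
  prolongable := fun z hz => by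
    rw [← Dhat_lift f hU hφ.smooth hz, hφ.φ_x z hz]
    exact neg_ne_zero.2 (hJ z hz)
  pullback := by
    intro z hz
    have hz0 := hJ z hz
    have ea : lift a1 z ≠ 0 := h0 _ (Set.mem_image_of_mem _ hz)
    -- The rows are the coefficients of dψ - χ dφ, dχ - η dφ, dη - f̄ dφ and dφ in the base coframe,
    -- read off from Steps 2 and 3. The product of the diagonal entries is a1³/J3².
    refine ⟨_, ⟨lift a1 z, -I5 f z * lift a1 z, -(lift a1 z / J3 f z),
      ((s + I5 f z ^ 2) / 2 + I2 f z / (2 * J3 f z ^ 2)) * lift a1 z,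
      (I5 f z / J3 f z + I1 f z / (3 * J3 f z ^ 2)) * lift a1 z, lift a1 z / J3 f z ^ 2,
      -I7 f z, -I4 f z, -J3 f z, ?_, rfl⟩, ?_⟩
    · simp [ea, hz0]
    have eη := h.eq_prolongQ hU hφ
    -- The two functions agree only on U; since U is open this suffices to exchange their
    -- derivatives.
    have hQ : prolongQ φ χ =ᶠ[nhds z] η :=
      Filter.eventually_of_mem (hU.mem_nhds hz) fun y hy => (eη y hy).symm
    have hη := differentiableAt_of_contDiffOn hU h.smooth_η hz
    have ex := h.χ_x z hz
    rw [Dhat_lift f hU h.smooth_χ hz, Dx] at ex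
    have ex0 : pd 0 (lift χ) z = -J3 f z * η z - z 2 * pd 1 (lift χ) z - z 3 * pd 2 (lift χ) z := by
      linear_combination ex
    have eh := h.η_x z hz
    rw [Dhat, Dx] at eh
    have eh0 : pd 0 η z = -J3 f z * (s * lift χ z + lift ψ z) - z 2 * pd 1 η z - z 3 * pd 2 η z
        - f z * pd 3 η z := by
      linear_combination eh
    intro i
    ext w
    simp only [ContinuousLinearMap.comp_apply, Fin.sum_univ_four, add_apply, smul_apply,
      coframe_apply]
    rw [fderiv_prolong_apply (differentiableAt_of_contDiffOn hU (contDiffOn_lift hφ.smooth) hz)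
      (differentiableAt_of_contDiffOn hU (contDiffOn_lift h.smooth_ψ) hz)
      (differentiableAt_of_contDiffOn hU (contDiffOn_lift h.smooth_χ) hz)
      (hη.congr_of_eventuallyEq hQ), hQ.fderiv_eq]
    have wφ := fderiv_apply_eq_sum (lift φ) z w
    have wψ := fderiv_apply_eq_sum (lift ψ) z w
    have wχ := fderiv_apply_eq_sum (lift χ) z w
    have wη := fderiv_apply_eq_sum η z w
    rw [Fin.sum_univ_four, pd_three_lift hU hφ.smooth hz, hφ.pd_zero hU hz, hφ.φ_u z hz,
      hφ.φ_p z hz] at wφ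
    rw [Fin.sum_univ_four, pd_three_lift hU h.smooth_ψ hz, h.ψ_x z hz, h.ψ_contact hJ hφ z hz,
      h.ψ_p z hz, hφ.pd_zero hU hz, hφ.φ_u z hz] at wψ
    rw [Fin.sum_univ_four, pd_three_lift hU h.smooth_χ hz, ex0, h.χ_u z hz, h.χ_p z hz] at wχ
    rw [Fin.sum_univ_four, eh0, h.η_u z hz, h.η_p z hz, h.η_q z hz] at wη
    rw [wφ, wψ, wχ, wη]
    fin_cases i <;> simp [prolong, canonicalRHS, ← eη z hz] <;> ring

end Outcome

end ContactODE
end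

/-! ### The proposition -/

theorem mainTheorem3
    (U : Set ContactODE.J2) (hU : IsOpen U)
    (f : ContactODE.J2 → ℝ) (hf : ContDiffOn ℝ ∞ f U) (s : ℝ)
    (φ ψ χ lam : ContactODE.J1 → ℝ)
    (h : ContactODE.IsContactEquivalence U f (ContactODE.canonicalRHS s) φ ψ χ lam) :
    -- the invariants are defined, and they determine the constant `s`
    (∀ z ∈ U, ContactODE.I3 f z ≠ 0 ∧ ContactODE.K f z = s) ∧
    -- the given transformation and its nowhere vanishing multiplier solve the three systems
    (∀ v ∈ ContactODE.proj '' U, lam v ≠ 0) ∧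
    ContactODE.StepOne U f lam ∧
    ContactODE.StepTwo U f φ ∧
    ContactODE.StepThree U f s lam φ (ContactODE.prolongQ φ χ) χ ψ ∧
    -- whatever non-zero solutions are chosen in the first two steps, the third step is solvable
    (∀ a1 φ' : ContactODE.J1 → ℝ,
      ContactODE.StepOne U f a1 → (∀ v ∈ ContactODE.proj '' U, a1 v ≠ 0) →
      ContactODE.StepTwo U f φ' →
      ∃ (η' : ContactODE.J2 → ℝ) (χ' ψ' : ContactODE.J1 → ℝ),
        ContactODE.StepThree U f s a1 φ' η' χ' ψ') ∧
    -- every outcome of the three steps is a linearizing contact transformation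
    (∀ (a1 φ' : ContactODE.J1 → ℝ) (η' : ContactODE.J2 → ℝ) (χ' ψ' : ContactODE.J1 → ℝ),
      ContactODE.StepOne U f a1 → (∀ v ∈ ContactODE.proj '' U, a1 v ≠ 0) →
      ContactODE.StepTwo U f φ' →
      ContactODE.StepThree U f s a1 φ' η' χ' ψ' →
      ContactODE.IsContactEquivalence U f (ContactODE.canonicalRHS s) φ' ψ' χ' a1 ∧
        ∀ z ∈ U, η' z = ContactODE.prolongQ φ' χ' z) ∧
    -- on a connected domain, a solution of the first system that is not identically zero
    -- vanishes nowhere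
    (IsPreconnected U → ∀ a1 : ContactODE.J1 → ℝ, ContactODE.StepOne U f a1 →
      (∃ v ∈ ContactODE.proj '' U, a1 v ≠ 0) → ∀ v ∈ ContactODE.proj '' U, a1 v ≠ 0) := by
  open ContactODE in
  have H := h.liftedEquivalence hU hf
  have hJ := h.J3_ne_zero hU hf
  have h1 := h.stepOne hU hf
  have h2 := h.stepTwo hU hf
  have h3 := h.stepThree hU hf
  have hl : ∀ v ∈ proj '' U, lam v ≠ 0 := by
    rintro _ ⟨z, hz, rfl⟩
    exact h.lift_lam_ne_zero hU z hz
  have hc : ∀ a1, StepOne U f a1 → ContDiffOn ℝ ∞ (fun v => a1 v / lam v) (proj '' U) :=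
    fun a1 ha => ha.smooth.div h1.smooth hl
  refine ⟨fun z hz => ⟨?_, H.K_eq z hz⟩, hl, h1, h2, h3, ?_, ?_, ?_⟩
  · rw [← cbrt_pow_three (I3 f z)]
    exact pow_ne_zero 3 (hJ z hz)
  · intro a1 φ' ha _ hφ'
    have T := h3.lift_mul hU h2 hφ' (hc a1 ha)
      (ha.pd_div_eq_zero hU h1 (h.lift_lam_ne_zero hU))
    -- The product (a1/λ)·λ is known to equal a1 only where λ ≠ 0. Step 3 uses values of a1 on U and
    -- no derivatives of it, so the fields mentioning a1 are rewritten pointwise and the others are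
    -- inherited.
    have e : ∀ z ∈ U, lift (fun v => a1 v / lam v * lam v) z = lift a1 z := fun z hz =>
      div_mul_cancel₀ _ (h.lift_lam_ne_zero hU z hz)
    refine ⟨_, _, _,
      { T with
        η_u := fun z hz => ?_
        η_p := fun z hz => ?_
        η_q := fun z hz => ?_
        χ_u := fun z hz => ?_
        χ_p := fun z hz => ?_
        ψ_u := fun z hz => ?_
        ψ_x := fun z hz => ?_ }⟩
    · rw [T.η_u z hz, e z hz]
    · rw [T.η_p z hz, e z hz]
    · rw [T.η_q z hz, e z hz]
    · rw [T.χ_u z hz, e z hz]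
    · rw [T.χ_p z hz, e z hz]
    · rw [T.ψ_u z hz, e z hz]
    · rw [T.ψ_x z hz, e z hz]
  · intro a1 φ' η' χ' ψ' _ h0 hφ' T
    exact ⟨T.isContactEquivalence hU hJ h0 hφ', T.eq_prolongQ hU hφ'⟩
  · rintro hconn a1 ha ⟨_, ⟨z₀, hz₀, rfl⟩, h0⟩ _ ⟨z, hz, rfl⟩ hz0
    have hd := ha.pd_div_eq_zero hU h1 (h.lift_lam_ne_zero hU)
    -- Constancy of a1/λ is obtained on the connected set U through the lift; a zero of a1 at one
    -- point would then force a zero at the point where a1 ≠ 0.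
    have e : lift (fun v => a1 v / lam v) z₀ = lift (fun v => a1 v / lam v) z :=
      hU.is_const_of_fderiv_eq_zero hconn
        ((contDiffOn_lift (hc a1 ha)).differentiableOn (by simp))
        (fun y hy => by
          ext w
          rw [fderiv_apply_eq_sum]
          simp [hd y hy]) hz₀ hz
    have e' : a1 (proj z₀) / lam (proj z₀) = a1 (proj z) / lam (proj z) := e
    rw [hz0, zero_div] at e'
    exact div_ne_zero h0 (hl _ (Set.mem_image_of_mem _ hz₀)) e'
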